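/- Let $\mathbb F_q$ be the finite field with $q$ elements and let $u_2,u_3,k$ be integers with $1<u_2<u_3<k$ and $u_2+u_3\le k+1$. There exist subspaces $U_2,U_3\subseteq\mathbb F_q^k$ with $\dim U_2=u_2$, $\dim U_3=u_3$ and $\dim(U_2\cap U_3)=1$. For any such pair put $U_1=U_2\cap U_3$ and $u_1=1$; there exists a matrix $G$ whose columns represent, each exactly once, the projective points of $\mathbb F_q^k$ lying outside $U_2\cup U_3$. For any such $G$, with $k$ rows and $n$ columns, the linear code $C=\{\mathbf yG\mid \mathbf y\in\mathbb F_q^k\}$ has length, dimension and minimum Hamming distance $$n=\frac{q^k-1}{q-1}-\frac{q^{u_2}-1}{q-1}-\frac{q^{u_3}-1}{q-1}+1,\qquad \dim C=k,\qquad d=q^{k-1}-q^{u_2-1}-q^{u_3-1}.$$ Let $A_j(C)$ be the number of codewords of Hamming weight $j$. For a subspace $U\subseteq C$ let $w(U)$ be the number of coordinates at which some word of $U$ is nonzero. For $1\le r\le k$ let $d_r(C)=\min\{w(U)\mid U\subseteq C,\ \dim U=r\}$, let $A_j^r(C)$ be the number of $r$-dimensional subspaces $U\subseteq C$ with $w(U)=j$,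 and let $$\delta_r(C)=n-d_r(C)-\sum_{i=1}^{k-r}\Big\lceil\frac{(q-1)d_r(C)}{q^i(q^r-1)}\Big\rceil .$$ (a) If $u_2+u_3<k+1$, then $C$ is a $5$-weight code, with $A_0(C)=1$, $A_d(C)=q^{k-1}-q^{k-u_2}-q^{k-u_3}+q^{k-u_2-u_3+1}$, $A_{d+1}(C)=q^k-q^{k-1}$, $A_{d+q^{u_2-1}}(C)=q^{k-u_2}-q^{k-u_2-u_3+1}$, $A_{d+q^{u_3-1}}(C)=q^{k-u_3}-q^{k-u_2-u_3+1}$, $A_{d+q^{u_2-1}+q^{u_3-1}}(C)=q^{k-u_2-u_3+1}-1$, and $A_j(C)=0$ for all other $j$. (b) If $u_2+u_3=k+1$, then $C$ is a $4$-weight code, with $A_0(C)$, $A_d(C)$, $A_{d+1}(C)$, $A_{d+q^{u_2-1}}(C)$, $A_{d+q^{u_3-1}}(C)$ given by the same formulas and $A_j(C)=0$ for all other $j$. (c) $$d_r(C)=\begin{cases}\dfrac{q^k-q^{k-r}-(q^{u_2}-q^{u_2-r})-(q^{u_3}-q^{u_3-r})}{q-1},&1\le r<u_2,\\[2mm] \dfrac{q^k-q^{k-r}-(q^{u_2}-1)-(q^{u_3}-q^{u_3-r})}{q-1}+1,&u_2\le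 r<u_3,\\[2mm] \dfrac{q^k-q^{k-r}-(q^{u_2}-1)-(q^{u_3}-1)}{q-1}+1,&u_3\le r\le k.\end{cases}$$ (d) Let $M^{1,u_2,u_3,k}_{v_1,v_2,v_3,m}$ be the number of $m$-dimensional subspaces $V\subseteq\mathbb F_q^k$ with $\dim(W_i\cap V)=v_i$ for $i=1,2,3$, where $W_2,W_3\subseteq\mathbb F_q^k$ are any subspaces of dimensions $u_2,u_3$ such that $W_1=W_2\cap W_3$ has dimension $1$. Then, whichever such $W_2,W_3$ are used, for $1\le r\le k$ and $1\le j\le n$, $$A_j^r(C)=\sum_{(v_1,v_2,v_3)\in\mathbf Z(q,m_{r,j})}M^{1,u_2,u_3,k}_{v_1,v_2,v_3,k-r},\qquad m_{r,j}=j-\frac{q^k-q^{k-r}}{q-1}+\frac{q^{u_2}-1}{q-1}+\frac{q^{u_3}-1}{q-1}-1,$$ where $\mathbf Z(q,m_{r,j})$ is the set of $(v_1,v_2,v_3)\in\mathbb Z^3$ such that $\max\{0,u_i-r\}\le v_i\le\min\{u_i,k-r\}$ for $1\le i\le 3$, $0\le v_i-v_1\le u_i-1$ for $i=2,3$, $v_2+v_3\le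 k-r+v_1$, and $m_{r,j}=\frac{q^{v_2}-1}{q-1}+\frac{q^{v_3}-1}{q-1}-\frac{q^{v_1}-1}{q-1}$. (e) $C$ is a $u_2$-Griesmer code, i.e. $u_2$ is the least $r\in\{1,\dots,k\}$ with $\delta_r(C)=0$; it is an almost Griesmer code, i.e. $\delta_1(C)=1$; and it is distance-optimal, i.e. no linear code over $\mathbb F_q$ of length $n$ and dimension $k$ has minimum Hamming distance larger than $d$. -/

import Mathlib

namespace SubcodeSupport

variable {F : Type*} [Field F]

/-- The support of a linear (sub)code `U ≤ F^n`: the coordinates at which some word of `U` is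
nonzero. -/
def supp {n : ℕ} (U : Submodule F (Fin n → F)) : Set (Fin n) :=
  {i | ∃ x ∈ U, x i ≠ 0}

/-- The subcode support weight `w(U) = |supp(U)|`. -/
noncomputable def suppWeight {n : ℕ} (U : Submodule F (Fin n → F)) : ℕ :=
  (supp U).ncard

/-- The minimum Hamming distance of a linear code of positive dimension. -/
noncomputable def minDist [DecidableEq F] {n : ℕ} (C : Submodule F (Fin n → F)) : ℕ :=
  sInf {d | ∃ x ∈ C, ∃ y ∈ C, x ≠ y ∧ hammingDist x y = d}

/-- The `r`-generalized Hamming weight `d_r(C)`, for `1 ≤ r ≤ dim C`. -/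
noncomputable def ghw {n : ℕ} (C : Submodule F (Fin n → F)) (r : ℕ) : ℕ :=
  sInf {w | ∃ U : Submodule F (Fin n → F), U ≤ C ∧ Module.finrank F U = r ∧ suppWeight U = w}

/-- `A_j(C)`: the number of codewords of Hamming weight `j`. -/
noncomputable def weightCount [DecidableEq F] {n : ℕ} (C : Submodule F (Fin n → F)) (j : ℕ) : ℕ :=
  {c : Fin n → F | c ∈ C ∧ hammingNorm c = j}.ncard

/-- `C` is a `t`-weight code: exactly `t` positive integers `j ≤ n` are weights of codewords. -/
def IsWeightCode [DecidableEq F] {n : ℕ} (C : Submodule F (Fin n → F)) (t : ℕ) : Prop :=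
  {j : ℕ | 1 ≤ j ∧ j ≤ n ∧ weightCount C j ≠ 0}.ncard = t

/-- `A_j^r(C)`: the number of `r`-dimensional subcodes of `C` with subcode support weight `j`. -/
noncomputable def subcodeCount {n : ℕ} (C : Submodule F (Fin n → F)) (r j : ℕ) : ℕ :=
  {U : Submodule F (Fin n → F) | U ≤ C ∧ Module.finrank F U = r ∧ suppWeight U = j}.ncard

/-- The `r`-Griesmer defect
`δ_r(C) = n - d_r(C) - ∑_{i=1}^{k-r} ⌈(q-1) d_r(C) / (q^i (q^r - 1))⌉`, with `k = dim C`. -/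
noncomputable def griesmerDefect [Fintype F] {n : ℕ} (C : Submodule F (Fin n → F)) (r : ℕ) : ℤ :=
  (n : ℤ) - (ghw C r : ℤ) - ∑ i ∈ Finset.Icc 1 (Module.finrank F C - r),
    ⌈(((Fintype.card F : ℚ) - 1) * (ghw C r : ℚ)) /
      ((Fintype.card F : ℚ) ^ i * ((Fintype.card F : ℚ) ^ r - 1))⌉

/-- `C` is an `r`-Griesmer code: `r` is the least `1 ≤ j ≤ dim C` with `δ_j(C) = 0`. -/
def IsRGriesmer [Fintype F] {n : ℕ} (C : Submodule F (Fin n → F)) (r : ℕ) : Prop :=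
  IsLeast {j : ℕ | 1 ≤ j ∧ j ≤ Module.finrank F C ∧ griesmerDefect C j = 0} r

/-- `C` is an almost Griesmer code: `δ_1(C) = 1`. -/
def IsAlmostGriesmer [Fintype F] {n : ℕ} (C : Submodule F (Fin n → F)) : Prop :=
  griesmerDefect C 1 = 1

/-- `C` is distance-optimal: no linear code over `F` of the same length and dimension has a larger
minimum distance. -/
def IsDistanceOptimal [DecidableEq F] {n : ℕ} (C : Submodule F (Fin n → F)) : Prop :=
  ¬ ∃ C' : Submodule F (Fin n → F),
    Module.finrank F C' = Module.finrank F C ∧ minDist C < minDist C'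

/-- `U₂, U₃` are subspaces of `F^k` of dimensions `u₂, u₃` whose intersection `U₁ = U₂ ∩ U₃` is
one-dimensional. -/
structure IsPair {k : ℕ} (u₂ u₃ : ℕ) (U₂ U₃ : Submodule F (Fin k → F)) : Prop where
  finrank_two : Module.finrank F U₂ = u₂
  finrank_three : Module.finrank F U₃ = u₃
  finrank_inf : Module.finrank F (U₂ ⊓ U₃ : Submodule F (Fin k → F)) = 1

/-- The columns of `G` are representatives, one for each, of the projective points of `F^k` that
lie outside `U₂ ∪ U₃`. -/
structure IsComplementMatrix {k n : ℕ} (U₂ U₃ : Submodule F (Fin k → F))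
    (G : Matrix (Fin k) (Fin n) F) : Prop where
  indep : ∀ i j : Fin n, i ≠ j → LinearIndependent F ![G.col i, G.col j]
  notMem : ∀ j : Fin n, G.col j ∉ U₂ ∧ G.col j ∉ U₃
  exhaust : ∀ x : Fin k → F, x ∉ U₂ → x ∉ U₃ → ∃ (j : Fin n) (a : F), x = a • G.col j

/-- The linear code generated by the rows of `G`. -/
def rowCode {k n : ℕ} (G : Matrix (Fin k) (Fin n) F) : Submodule F (Fin n → F) :=
  Submodule.span F (Set.range G.row)

/-- The count `M^{u₁,u₂,u₃,k}_{v₁,v₂,v₃,m}`: the number of `m`-dimensional subspaces `V` of `F^k`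
with `dim (Uᵢ ∩ V) = vᵢ` for `i = 1, 2, 3`, where `U₁ = U₂ ∩ U₃`. -/
noncomputable def M {k : ℕ} (U₂ U₃ : Submodule F (Fin k → F)) (v₁ v₂ v₃ m : ℕ) : ℕ :=
  {V : Submodule F (Fin k → F) | Module.finrank F V = m ∧
    Module.finrank F (U₂ ⊓ U₃ ⊓ V : Submodule F (Fin k → F)) = v₁ ∧
    Module.finrank F (U₂ ⊓ V : Submodule F (Fin k → F)) = v₂ ∧
    Module.finrank F (U₃ ⊓ V : Submodule F (Fin k → F)) = v₃}.ncard

/-- The number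
`m_{r,j} = j - (q^k-q^{k-r})/(q-1) + (q^{u₂}-1)/(q-1) + (q^{u₃}-1)/(q-1) - 1`. -/
def mNumber (q k u₂ u₃ r j : ℕ) : ℚ :=
  (j : ℚ) - ((q : ℚ) ^ k - (q : ℚ) ^ (k - r)) / ((q : ℚ) - 1)
    + ((q : ℚ) ^ u₂ - 1) / ((q : ℚ) - 1) + ((q : ℚ) ^ u₃ - 1) / ((q : ℚ) - 1) - 1

/-- The index set `Z(q, m_{r,j})` of triples `(v₁, v₂, v₃)`, for `1 ≤ r ≤ k` and `u₁ = 1`. The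
truncated difference `uᵢ - r` is `max {0, uᵢ - r}`. -/
def Z (q k u₂ u₃ r j : ℕ) : Finset (ℕ × ℕ × ℕ) :=
  (Finset.range 2 ×ˢ Finset.range (u₂ + 1) ×ˢ Finset.range (u₃ + 1)).filter fun v =>
    (1 - r ≤ v.1 ∧ v.1 ≤ min 1 (k - r)) ∧
    (u₂ - r ≤ v.2.1 ∧ v.2.1 ≤ min u₂ (k - r)) ∧
    (u₃ - r ≤ v.2.2 ∧ v.2.2 ≤ min u₃ (k - r)) ∧
    (v.1 ≤ v.2.1 ∧ v.2.1 - v.1 ≤ u₂ - 1) ∧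
    (v.1 ≤ v.2.2 ∧ v.2.2 - v.1 ≤ u₃ - 1) ∧
    v.2.1 + v.2.2 ≤ k - r + v.1 ∧
    mNumber q k u₂ u₃ r j =
      ((q : ℚ) ^ v.2.1 - 1) / ((q : ℚ) - 1) + ((q : ℚ) ^ v.2.2 - 1) / ((q : ℚ) - 1)
        - ((q : ℚ) ^ v.1 - 1) / ((q : ℚ) - 1)

end SubcodeSupport

/-! Everything is read off in the dual picture. Coordinate `j` of `yG` is the dot product of `y`
with column `j`, so the image of a subspace `D` vanishes exactly at the columns lying in `D^⊥`
(`suppWeight_map_add_colCount`). Inclusion-exclusion gives the number of columns in any subspace `V`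
from the dimensions of `V`, `U₂ ∩ V`, `U₃ ∩ V` and `U₂ ∩ U₃ ∩ V` (`colCount_eq`).

Taking `V` to be a hyperplane `y^⊥` shows that the weight of `yG` depends only on which of `U₂^⊥`,
`U₃^⊥`, `(U₂ ∩ U₃)^⊥` contain `y`; counting each class gives the weight distribution. Taking `V` of
codimension `r` parametrizes the `r`-dimensional subcodes: `d_r` comes from minimizing `q^v₂ + q^v₃
- q^v₁`, attained by subspaces in general position (`exists_le_finrank_sup_eq_min`), and `A_j^r`
comes from sorting the `V` by `(v₁, v₂, v₃)`. All pairs are equivalent under linear automorphisms,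
so the counts `M` do not depend on the pair.

The Griesmer terms for these `d_r` are differences of powers of `q` (`ceil_eq_griesmerTerm`), so the
defects reduce to geometric sums. Since `δ_1 = 1`, the Griesmer sum for `d` is `n - 1`; replacing
`d` by `d + 1` raises at least `u₂ ≥ 2` of its terms, which contradicts the Griesmer bound. -/

namespace SubcodeSupport

open Module

/-! ### Subspaces in general position and point counts. -/

section LinearAlgebra

variable {K V : Type*} [Field K] [AddCommGroup V] [Module K V]

/-- If a vector outside `A` and one outside `B` each lie in the other subspace, their sum avoids
both. The field may be `F_2`, where avoiding three subspaces could fail. -/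
theorem exists_notMem_notMem {A B : Submodule K V} (hA : A ≠ ⊤) (hB : B ≠ ⊤) :
    ∃ x, x ∉ A ∧ x ∉ B := by
  obtain ⟨x, hx⟩ := SetLike.exists_not_mem_of_ne_top A hA rfl
  obtain ⟨y, hy⟩ := SetLike.exists_not_mem_of_ne_top B hB rfl
  by_cases hxB : x ∈ B
  · by_cases hyA : y ∈ A
    · exact ⟨x + y, fun h => hx ((A.add_mem_iff_left hyA).1 h),
        fun h => hy ((B.add_mem_iff_right hxB).1 h)⟩
    · exact ⟨y, hyA, hy⟩
  · exact ⟨x, hx, hxB⟩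

variable [FiniteDimensional K V]

theorem finrank_sup_span_singleton_of_notMem {A : Submodule K V} {x : V} (hx : x ∉ A) :
    finrank K (A ⊔ Submodule.span K {x} : Submodule K V) = finrank K A + 1 := by
  have hx0 : x ≠ 0 := fun h => hx (h ▸ A.zero_mem)
  have h := Submodule.finrank_sup_add_finrank_inf_eq A (Submodule.span K {x})
  have hd : A ⊓ Submodule.span K {x} = ⊥ := by
    rw [← disjoint_iff]
    exact (Submodule.disjoint_span_singleton' hx0).2 hx
  rw [hd, finrank_bot, finrank_span_singleton hx0] at h
  simpa using h

/-- A subspace can be enlarged to one of any larger dimension that is in general position with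
respect to two given subspaces. -/
theorem exists_le_finrank_sup_eq_min (V₀ A B : Submodule K V) (t : ℕ)
    (ht : finrank K V₀ + t ≤ finrank K V) :
    ∃ W : Submodule K V, V₀ ≤ W ∧ finrank K W = finrank K V₀ + t ∧
      finrank K (W ⊔ A : Submodule K V)
        = min (finrank K V) (finrank K (V₀ ⊔ A : Submodule K V) + t) ∧
      finrank K (W ⊔ B : Submodule K V)
        = min (finrank K V) (finrank K (V₀ ⊔ B : Submodule K V) + t) := by
  induction t with
  | zero =>
    refine ⟨V₀, le_rfl, rfl, ?_, ?_⟩ <;> simp [Submodule.finrank_le]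
  | succ t ih =>
    obtain ⟨W, hW, hd, h₁, h₂⟩ := ih (by omega)
    have hWt : W ≠ ⊤ := by
      rintro rfl
      rw [finrank_top] at hd
      omega
    -- `S` is what a new vector must avoid: `W ⊔ C` while that is proper, and otherwise `W` alone,
    -- since the sum can no longer grow. One vector avoiding both such subspaces serves `A` and `B`
    -- at once.
    have key : ∀ C : Submodule K V, ∃ S : Submodule K V, S ≠ ⊤ ∧ W ≤ S ∧ ∀ x, x ∉ S →
        finrank K (W ⊔ Submodule.span K {x} ⊔ C : Submodule K V)
          = min (finrank K V) (finrank K (W ⊔ C : Submodule K V) + 1) := by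
      intro C
      by_cases hC : W ⊔ C = ⊤
      · refine ⟨W, hWt, le_rfl, fun x _ => ?_⟩
        rw [sup_right_comm, hC, top_sup_eq, finrank_top]
        simp
      · refine ⟨W ⊔ C, hC, le_sup_left, fun x hx => ?_⟩
        rw [sup_right_comm, finrank_sup_span_singleton_of_notMem hx]
        have := Submodule.finrank_lt hC
        omega
    obtain ⟨S, hS, hWS, hSx⟩ := key A
    obtain ⟨T, hT, -, hTx⟩ := key B
    obtain ⟨x, hxS, hxT⟩ := exists_notMem_notMem hS hT
    refine ⟨W ⊔ Submodule.span K {x}, hW.trans le_sup_left, ?_, ?_, ?_⟩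
    · rw [finrank_sup_span_singleton_of_notMem (fun h => hxS (hWS h)), hd, add_assoc]
    · rw [hSx x hxS, h₁]
      omega
    · rw [hTx x hxT, h₂]
      omega

theorem ncard_setOf_mem [Fintype K] (A : Submodule K V) :
    {x | x ∈ A}.ncard = Fintype.card K ^ finrank K A := by
  rw [← Nat.card_eq_fintype_card, ← Module.natCard_eq_pow_finrank (K := K) (V := A)]
  rfl

/-- Inclusion-exclusion for the traces of `A` and `B` on `C`. The case `A = B` counts a plain
difference of subspaces. -/
theorem ncard_mem_notMem_notMem [Fintype K] (C A B : Submodule K V) :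
    ({x | x ∈ C ∧ x ∉ A ∧ x ∉ B}.ncard : ℤ)
      = (Fintype.card K : ℤ) ^ finrank K C
        - (Fintype.card K : ℤ) ^ finrank K (A ⊓ C : Submodule K V)
        - (Fintype.card K : ℤ) ^ finrank K (B ⊓ C : Submodule K V)
        + (Fintype.card K : ℤ) ^ finrank K (A ⊓ B ⊓ C : Submodule K V) := by
  have : Finite V := Module.finite_of_finite K
  have h₁ : {x | x ∈ C ∧ x ∉ A ∧ x ∉ B} = {x | x ∈ C} \ ({x | x ∈ A ⊓ C} ∪ {x | x ∈ B ⊓ C}) := by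
    ext x
    simp only [Set.mem_ofPred_eq, Set.mem_sdiff, Set.mem_union, Submodule.mem_inf]
    tauto
  have h₂ := Set.ncard_sdiff_add_ncard_of_subset
    (s := {x | x ∈ A ⊓ C} ∪ {x | x ∈ B ⊓ C}) (t := {x | x ∈ C}) (by
      rintro x (hx | hx)
      exacts [hx.2, hx.2]) (Set.toFinite _)
  have h₃ := Set.ncard_union_add_ncard_inter {x | x ∈ A ⊓ C} {x | x ∈ B ⊓ C}
  have h₄ : {x | x ∈ A ⊓ C} ∩ {x | x ∈ B ⊓ C} = {x | x ∈ A ⊓ B ⊓ C} := by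
    ext x
    simp only [Set.mem_inter_iff, Set.mem_ofPred_eq, Submodule.mem_inf]
    tauto
  rw [← h₁] at h₂
  rw [h₄] at h₃
  simp only [ncard_setOf_mem] at h₂ h₃
  zify at h₂ h₃
  linarith

end LinearAlgebra

/-! ### Orthogonal complements for the dot product. -/

section Orthogonal

variable {F : Type*} [Field F] {k : ℕ}

/-- The orthogonal complement of a subspace of `F^k` with respect to the dot product. -/
def dotOrth (D : Submodule F (Fin k → F)) : Submodule F (Fin k → F) :=
  LinearMap.BilinForm.orthogonal (dotProductBilin F F) D

theorem mem_dotOrth {D : Submodule F (Fin k → F)} {x : Fin k → F} :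
    x ∈ dotOrth D ↔ ∀ y ∈ D, y ⬝ᵥ x = 0 := Iff.rfl

theorem nondegenerate_dotProductBilin :
    LinearMap.BilinForm.Nondegenerate
      (dotProductBilin F F : LinearMap.BilinForm F (Fin k → F)) := by
  refine ⟨fun x hx => ?_, fun x hx => ?_⟩
  · exact dotProduct_eq_zero x hx
  · exact dotProduct_eq_zero x fun y => (dotProduct_comm _ _).trans (hx y)

theorem isRefl_dotProductBilin :
    LinearMap.BilinForm.IsRefl (dotProductBilin F F : LinearMap.BilinForm F (Fin k → F)) :=
  fun x y h => (dotProduct_comm y x).trans h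

theorem finrank_dotOrth (D : Submodule F (Fin k → F)) :
    finrank F (dotOrth D) = k - finrank F D := by
  rw [dotOrth, LinearMap.BilinForm.finrank_orthogonal nondegenerate_dotProductBilin,
    finrank_fin_fun]

theorem dotOrth_dotOrth (D : Submodule F (Fin k → F)) : dotOrth (dotOrth D) = D :=
  LinearMap.BilinForm.orthogonal_orthogonal nondegenerate_dotProductBilin
    isRefl_dotProductBilin D

theorem le_dotOrth_comm {A B : Submodule F (Fin k → F)} : A ≤ dotOrth B ↔ B ≤ dotOrth A := by
  constructor <;> exact fun h x hx y hy => (dotProduct_comm y x).trans (h hy x hx)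

theorem mem_dotOrth_iff_le {A : Submodule F (Fin k → F)} {y : Fin k → F} :
    y ∈ dotOrth A ↔ A ≤ dotOrth (Submodule.span F {y}) := by
  rw [le_dotOrth_comm, Submodule.span_singleton_le_iff_mem]

theorem dotOrth_sup (A B : Submodule F (Fin k → F)) :
    dotOrth (A ⊔ B) = dotOrth A ⊓ dotOrth B := by
  ext y
  simp only [Submodule.mem_inf, mem_dotOrth_iff_le, sup_le_iff]

theorem dotOrth_le_dotOrth {A B : Submodule F (Fin k → F)} (h : A ≤ B) :
    dotOrth B ≤ dotOrth A := LinearMap.BilinForm.orthogonal_le h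

/-- The complement of `y` is a hyperplane not containing `A`, so together they span the whole space.
-/
theorem finrank_inf_dotOrth_singleton {A : Submodule F (Fin k → F)} {y : Fin k → F}
    (hy : y ∉ dotOrth A) :
    finrank F (A ⊓ dotOrth (Submodule.span F {y}) : Submodule F (Fin k → F)) + 1
      = finrank F A := by
  have hy0 : y ≠ 0 := fun h => hy (h ▸ Submodule.zero_mem _)
  have h1 : finrank F (dotOrth (Submodule.span F {y})) = k - 1 := by
    rw [finrank_dotOrth, finrank_span_singleton hy0]
  have h2 := Submodule.finrank_sup_add_finrank_inf_eq A (dotOrth (Submodule.span F {y}))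
  have h3 : dotOrth (Submodule.span F {y})
      < A ⊔ dotOrth (Submodule.span F {y}) := by
    rw [right_lt_sup]
    exact fun h => hy (mem_dotOrth_iff_le.2 h)
  have h4 := Submodule.finrank_lt_finrank_of_lt h3
  have h5 := Submodule.finrank_le (A ⊔ dotOrth (Submodule.span F {y}))
  rw [finrank_fin_fun] at h5
  omega

end Orthogonal

/-! ### Counting columns in a subspace, and weights of codewords. -/

section Columns

variable {F : Type*} [Field F] {k n : ℕ} {U₂ U₃ : Submodule F (Fin k → F)}
  {G : Matrix (Fin k) (Fin n) F}

/-- The number of columns of `G` that lie in the subspace `V`. -/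
noncomputable def colCount (G : Matrix (Fin k) (Fin n) F) (V : Submodule F (Fin k → F)) : ℕ :=
  {j | G.col j ∈ V}.ncard

theorem rowCode_eq_range (G : Matrix (Fin k) (Fin n) F) :
    rowCode G = LinearMap.range G.vecMulLinear := (range_vecMulLinear G).symm

/-- A coordinate is outside the support of the image of `D` exactly when its column is orthogonal to
all of `D`. This turns support weights into incidence counts. -/
theorem suppWeight_map_add_colCount (G : Matrix (Fin k) (Fin n) F)
    (D : Submodule F (Fin k → F)) :
    suppWeight (D.map G.vecMulLinear) + colCount G (dotOrth D) = n := by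
  have h : supp (D.map G.vecMulLinear) = {j | G.col j ∈ dotOrth D}ᶜ := by
    ext j
    simp only [supp, Submodule.mem_map, Set.mem_ofPred_eq, Set.mem_compl_iff, mem_dotOrth,
      not_forall]
    constructor
    · rintro ⟨x, ⟨y, hy, rfl⟩, hx⟩
      exact ⟨y, hy, hx⟩
    · rintro ⟨y, hy, hx⟩
      exact ⟨_, ⟨y, hy, rfl⟩, hx⟩
  rw [suppWeight, h, colCount, add_comm, Set.ncard_add_ncard_compl, Nat.card_eq_fintype_card,
    Fintype.card_fin]

theorem hammingNorm_eq_suppWeight_span [DecidableEq F] (c : Fin n → F) :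
    hammingNorm c = suppWeight (Submodule.span F {c}) := by
  rw [hammingNorm, suppWeight, ← Set.ncard_coe_finset]
  congr 1
  ext j
  simp only [supp, Finset.coe_filter, Finset.mem_univ, true_and, Set.mem_ofPred_eq,
    Submodule.mem_span_singleton]
  constructor
  · exact fun h => ⟨c, ⟨1, one_smul _ _⟩, h⟩
  · rintro ⟨_, ⟨a, rfl⟩, h⟩ h0
    exact h (by simp [h0])

theorem hammingNorm_vecMul_add_colCount [DecidableEq F] (G : Matrix (Fin k) (Fin n) F)
    (y : Fin k → F) :
    hammingNorm (G.vecMulLinear y) + colCount G (dotOrth (Submodule.span F {y})) = n := by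
  have h := suppWeight_map_add_colCount G (Submodule.span F {y})
  rwa [Submodule.map_span, Set.image_singleton, ← hammingNorm_eq_suppWeight_span] at h

namespace IsComplementMatrix

theorem col_ne_zero (hG : IsComplementMatrix U₂ U₃ G) (j : Fin n) : G.col j ≠ 0 :=
  fun h => (hG.notMem j).1 (h ▸ U₂.zero_mem)

variable [Fintype F]

/-- Each vector outside `U₂ ∪ U₃` is a unit multiple of a unique column, and `V` is stable under
scaling, so each column in `V` accounts for `q - 1` vectors. -/
theorem card_sub_one_mul_colCount (hG : IsComplementMatrix U₂ U₃ G)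
    (V : Submodule F (Fin k → F)) :
    (Fintype.card F - 1) * colCount G V = {x | x ∈ V ∧ x ∉ U₂ ∧ x ∉ U₃}.ncard := by
  classical
  have himg : (fun p : Fˣ × Fin n => p.1 • G.col p.2) '' (Set.univ ×ˢ {j | G.col j ∈ V})
      = {x | x ∈ V ∧ x ∉ U₂ ∧ x ∉ U₃} := by
    ext x
    simp only [Set.mem_image, Set.mem_prod, Set.mem_univ, true_and, Set.mem_ofPred_eq,
      Prod.exists]
    constructor
    · rintro ⟨a, j, hj, rfl⟩
      exact ⟨V.smul_mem (a : F) hj, fun h => (hG.notMem j).1 ((U₂.smul_mem_iff' a).1 h),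
        fun h => (hG.notMem j).2 ((U₃.smul_mem_iff' a).1 h)⟩
    · rintro ⟨hV, h2, h3⟩
      obtain ⟨j, a, rfl⟩ := hG.exhaust x h2 h3
      have ha : a ≠ 0 := by
        rintro rfl
        exact h2 (by simp)
      exact ⟨Units.mk0 a ha, j, (V.smul_mem_iff ha).1 hV, rfl⟩
  have hinj : Function.Injective (fun p : Fˣ × Fin n => p.1 • G.col p.2) := by
    rintro ⟨a, i⟩ ⟨b, j⟩ h
    have h' : (a : F) • G.col i = (b : F) • G.col j := h
    obtain rfl : i = j := by
      by_contra hij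
      have := LinearIndependent.pair_iff.1 (hG.indep i j hij) a (-b) (by
        rw [h', neg_smul, add_neg_cancel])
      exact a.ne_zero this.1
    have := smul_left_injective F (hG.col_ne_zero i) h'
    rw [Units.ext this]
  rw [← himg, Set.ncard_image_of_injective _ hinj, Set.ncard_prod, Set.ncard_univ,
    Nat.card_units, Nat.card_eq_fintype_card, colCount]

theorem colCount_eq (hG : IsComplementMatrix U₂ U₃ G) (V : Submodule F (Fin k → F)) :
    ((Fintype.card F : ℤ) - 1) * colCount G V
      = (Fintype.card F : ℤ) ^ finrank F V
        - (Fintype.card F : ℤ) ^ finrank F (U₂ ⊓ V : Submodule F (Fin k → F))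
        - (Fintype.card F : ℤ) ^ finrank F (U₃ ⊓ V : Submodule F (Fin k → F))
        + (Fintype.card F : ℤ) ^ finrank F (U₂ ⊓ U₃ ⊓ V : Submodule F (Fin k → F)) := by
  rw [← ncard_mem_notMem_notMem, ← hG.card_sub_one_mul_colCount V]
  push_cast [Nat.cast_sub Fintype.card_pos]
  rfl

theorem length_eq (hG : IsComplementMatrix U₂ U₃ G) {u₂ u₃ : ℕ} (hU : IsPair u₂ u₃ U₂ U₃) :
    ((Fintype.card F : ℤ) - 1) * n
      = (Fintype.card F : ℤ) ^ k - (Fintype.card F : ℤ) ^ u₂ - (Fintype.card F : ℤ) ^ u₃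
        + Fintype.card F := by
  have h := hG.colCount_eq ⊤
  have hn : colCount G ⊤ = n := by
    simp [colCount, Set.ncard_univ]
  rw [hn, inf_top_eq, inf_top_eq, inf_top_eq] at h
  simpa [hU.finrank_two, hU.finrank_three, hU.finrank_inf] using h

/-- The weight of the codeword `yG`. -/
theorem hammingNorm_vecMul [DecidableEq F] [DecidablePred (· ∈ dotOrth U₂)]
    [DecidablePred (· ∈ dotOrth U₃)] [DecidablePred (· ∈ dotOrth (U₂ ⊓ U₃))]
    (hG : IsComplementMatrix U₂ U₃ G) {u₂ u₃ : ℕ} (hU : IsPair u₂ u₃ U₂ U₃)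
    {y : Fin k → F} (hy : y ≠ 0) :
    (hammingNorm (G.vecMulLinear y) : ℤ)
      = (Fintype.card F : ℤ) ^ (k - 1)
        - (if y ∈ dotOrth U₂ then 0 else (Fintype.card F : ℤ) ^ (u₂ - 1))
        - (if y ∈ dotOrth U₃ then 0 else (Fintype.card F : ℤ) ^ (u₃ - 1))
        + (if y ∈ dotOrth (U₂ ⊓ U₃) then 0 else 1) := by
  have hq : (1 : ℤ) < Fintype.card F := by exact_mod_cast Fintype.one_lt_card
  have h1 := hG.colCount_eq (dotOrth (Submodule.span F {y}))
  have h2 := hG.length_eq hU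
  have h3 := hammingNorm_vecMul_add_colCount G y
  have hk : 1 ≤ k := by
    rcases Nat.eq_zero_or_pos k with rfl | h
    · exact absurd (Subsingleton.elim y 0) hy
    · exact h
  -- The hyperplane `y^⊥` either contains `A` or cuts its dimension by one, and `q^a - q^(a-1) = (q
  -- - 1) q^(a-1)`. For `A = U₂ ∩ U₃` the last power is `1`.
  have key : ∀ (A : Submodule F (Fin k → F)) [Decidable (y ∈ dotOrth A)],
      (Fintype.card F : ℤ) ^ finrank F A
        - (Fintype.card F : ℤ) ^
          finrank F (A ⊓ dotOrth (Submodule.span F {y}) : Submodule F (Fin k → F))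
      = ((Fintype.card F : ℤ) - 1) *
        (if y ∈ dotOrth A then 0 else (Fintype.card F : ℤ) ^ (finrank F A - 1)) := by
    intro A _
    split_ifs with h
    · rw [inf_eq_left.2 (mem_dotOrth_iff_le.1 h)]
      ring
    · rw [← finrank_inf_dotOrth_singleton h, Nat.add_sub_cancel]
      ring
  have k2 := key U₂
  have k3 := key U₃
  have k1 := key (U₂ ⊓ U₃)
  rw [hU.finrank_two] at k2
  rw [hU.finrank_three] at k3
  rw [hU.finrank_inf, pow_one, Nat.sub_self, pow_zero] at k1
  rw [finrank_dotOrth, finrank_span_singleton hy] at h1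
  obtain ⟨m, rfl⟩ : ∃ m, k = m + 1 := ⟨k - 1, by omega⟩
  zify at h3
  rw [Nat.add_sub_cancel] at h1 ⊢
  refine mul_left_cancel₀ (sub_ne_zero.2 hq.ne') ?_
  rw [mul_add, mul_sub, mul_sub, ← k1, ← k2, ← k3,
    show (hammingNorm (G.vecMulLinear y) : ℤ)
      = n - colCount G (dotOrth (Submodule.span F {y})) by linarith, mul_sub, h1, h2]
  ring

end IsComplementMatrix

theorem exists_isComplementMatrix [Fintype F] (U₂ U₃ : Submodule F (Fin k → F)) :
    ∃ (n : ℕ) (G : Matrix (Fin k) (Fin n) F), IsComplementMatrix U₂ U₃ G := by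
  classical
  let P := {p : Projectivization F (Fin k → F) // p.rep ∉ U₂ ∧ p.rep ∉ U₃}
  have : Finite (Projectivization F (Fin k → F)) := inferInstance
  have : Finite P := inferInstance
  let e := Finite.equivFin P
  refine ⟨Nat.card P, Matrix.of fun i j => (e.symm j).1.rep i, ?_, ?_, ?_⟩
  · intro i j hij
    have : (e.symm i).1 ≠ (e.symm j).1 := fun h => hij (e.symm.injective (Subtype.ext h))
    exact Projectivization.linearIndependent_pair_iff_ne.2 this
  · exact fun j => (e.symm j).2
  · intro x h2 h3
    have hx : x ≠ 0 := fun h => h2 (h ▸ U₂.zero_mem)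
    obtain ⟨a, ha⟩ := Projectivization.exists_smul_eq_mk_rep F x hx
    have hp : (Projectivization.mk F x hx).rep ∉ U₂ ∧ (Projectivization.mk F x hx).rep ∉ U₃ := by
      rw [← ha]
      exact ⟨fun h => h2 ((U₂.smul_mem_iff' a).1 h), fun h => h3 ((U₃.smul_mem_iff' a).1 h)⟩
    refine ⟨e ⟨_, hp⟩, ((a⁻¹ : Fˣ) : F), ?_⟩
    have : (Matrix.of fun i j => (e.symm j).1.rep i).col (e ⟨_, hp⟩) = a • x := by
      ext i
      simp [Matrix.col, ← ha]
    rw [this]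
    exact (inv_smul_smul a x).symm

end Columns

/-! ### Existence of pairs, and their equivalence under automorphisms. -/

section Pairs

variable {F : Type*} [Field F] {k u₂ u₃ : ℕ}

theorem exists_finrank_eq (F : Type*) [Field F] (k m : ℕ) (h : m ≤ k) :
    ∃ U : Submodule F (Fin k → F), finrank F U = m := by
  obtain ⟨W, -, hW, -⟩ := exists_le_finrank_sup_eq_min (⊥ : Submodule F (Fin k → F)) ⊥ ⊥ m
    (by simpa using h)
  exact ⟨W, by simpa using hW⟩

/-- Both subspaces are grown from a common line, `U₃` generically with respect to `U₂`. The bound on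
`u₂ + u₃` leaves room for a sum of dimension `u₂ + u₃ - 1`, which forces the intersection back to a
line. -/
theorem exists_isPair (h₂ : 1 ≤ u₂) (h₃ : 1 ≤ u₃) (hsum : u₂ + u₃ ≤ k + 1) :
    ∃ U₂ U₃ : Submodule F (Fin k → F), IsPair u₂ u₃ U₂ U₃ := by
  obtain ⟨U₁, h1⟩ := exists_finrank_eq F k 1 (by omega)
  obtain ⟨U₂, hle, h2, -⟩ := exists_le_finrank_sup_eq_min U₁ ⊥ ⊥ (u₂ - 1)
    (by rw [finrank_fin_fun]; omega)
  obtain ⟨U₃, -, h3, h4, -⟩ := exists_le_finrank_sup_eq_min U₁ U₂ U₂ (u₃ - 1)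
    (by rw [finrank_fin_fun]; omega)
  rw [sup_eq_right.2 hle, finrank_fin_fun] at h4
  have h5 := Submodule.finrank_sup_add_finrank_inf_eq U₃ U₂
  refine ⟨U₂, U₃, by omega, by omega, ?_⟩
  rw [inf_comm]
  omega

theorem IsPair.finrank_sup {U₂ U₃ : Submodule F (Fin k → F)} (hU : IsPair u₂ u₃ U₂ U₃) :
    finrank F (U₂ ⊔ U₃ : Submodule F (Fin k → F)) + 1 = u₂ + u₃ := by
  rw [← hU.finrank_two, ← hU.finrank_three, ← hU.finrank_inf,
    Submodule.finrank_sup_add_finrank_inf_eq]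

theorem exists_sup_eq_finrank_add {K V : Type*} [Field K] [AddCommGroup V] [Module K V]
    [FiniteDimensional K V] {A B : Submodule K V} (h : A ≤ B) :
    ∃ C : Submodule K V, A ⊔ C = B ∧ finrank K A + finrank K C = finrank K B := by
  obtain ⟨C, hC⟩ := Submodule.exists_isCompl A
  have hs : A ⊔ C ⊓ B = B := by
    rw [← sup_inf_assoc_of_le _ h, hC.sup_eq_top, top_inf_eq]
  refine ⟨C ⊓ B, hs, ?_⟩
  have := Submodule.finrank_sup_add_finrank_inf_eq A (C ⊓ B)
  rw [hs, ← inf_assoc, hC.inf_eq_bot, bot_inf_eq, finrank_bot] at this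
  omega

/-- Two decompositions of a space into subspaces of the same dimensions are related by a linear
automorphism. -/
theorem exists_linearEquiv_map_eq {K V ι : Type*} [Field K] [AddCommGroup V] [Module K V]
    [FiniteDimensional K V] [Fintype ι] (A B : ι → Submodule K V)
    (hA : ⨆ i, A i = ⊤) (hB : ⨆ i, B i = ⊤) (hAd : ∑ i, finrank K (A i) = finrank K V)
    (hAB : ∀ i, finrank K (A i) = finrank K (B i)) :
    ∃ e : V ≃ₗ[K] V, ∀ i, (A i).map e.toLinearMap = B i := by
  -- Bases of the summands are concatenated, both families being indexed by the dimensions of `A`.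
  -- Independence then follows from spanning together with the cardinality.
  let w : (D : ι → Submodule K V) → (∀ i, finrank K (A i) = finrank K (D i)) →
      (Σ i, Fin (finrank K (A i))) → V :=
    fun D h p => ((finBasis K (D p.1)).reindex (finCongr (h p.1).symm) p.2 : V)
  have hspan : ∀ D h i, Submodule.span K (Set.range fun j => w D h ⟨i, j⟩) = D i := by
    intro D h i
    have : (Set.range fun j => w D h ⟨i, j⟩)
        = (D i).subtype '' Set.range ((finBasis K (D i)).reindex (finCongr (h i).symm)) := by
      rw [← Set.range_comp]
      rfl
    rw [this, Submodule.span_image, Basis.span_eq, Submodule.map_top, Submodule.range_subtype]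
  have htop : ∀ D h, ⨆ i, D i = ⊤ → ⊤ ≤ Submodule.span K (Set.range (w D h)) := by
    intro D h hD
    rw [← hD]
    refine iSup_le fun i => ?_
    rw [← hspan D h i]
    refine Submodule.span_mono ?_
    rintro _ ⟨j, rfl⟩
    exact ⟨_, rfl⟩
  have hcard : Fintype.card (Σ i, Fin (finrank K (A i))) = finrank K V := by
    simpa using hAd
  let bA := basisOfTopLeSpanOfCardEqFinrank (w A fun _ => rfl) (htop A (fun _ => rfl) hA) hcard
  let bB := basisOfTopLeSpanOfCardEqFinrank (w B hAB) (htop B hAB hB) hcard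
  refine ⟨bA.equiv bB (Equiv.refl _), fun i => ?_⟩
  rw [← hspan A (fun _ => rfl) i, ← hspan B hAB i, Submodule.map_span, ← Set.range_comp]
  congr 2
  ext1 j
  have h1 : w A (fun _ => rfl) ⟨i, j⟩ = bA ⟨i, j⟩ := by simp [bA]
  have h2 : w B hAB ⟨i, j⟩ = bB ⟨i, j⟩ := by simp [bB]
  simp only [Function.comp_apply, LinearEquiv.coe_coe]
  rw [h1, h2, Basis.equiv_apply, Equiv.refl_apply]

/-- A pair splits the space into `U₂ ∩ U₃`, a complement of it in each of `U₂` and `U₃`, and a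
complement of `U₂ ⊔ U₃`. The four dimensions depend only on `u₂`, `u₃`, `k`. -/
theorem IsPair.exists_linearEquiv {U₂ U₃ W₂ W₃ : Submodule F (Fin k → F)}
    (hU : IsPair u₂ u₃ U₂ U₃) (hW : IsPair u₂ u₃ W₂ W₃) :
    ∃ e : (Fin k → F) ≃ₗ[F] (Fin k → F),
      U₂.map e.toLinearMap = W₂ ∧ U₃.map e.toLinearMap = W₃ := by
  have key : ∀ {U₂ U₃ : Submodule F (Fin k → F)}, IsPair u₂ u₃ U₂ U₃ →
      ∃ A : Fin 4 → Submodule F (Fin k → F), A 0 ⊔ A 1 = U₂ ∧ A 0 ⊔ A 2 = U₃ ∧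
        ⨆ i, A i = ⊤ ∧ ∑ i, finrank F (A i) = k ∧
        ∀ i, finrank F (A i) = ![1, u₂ - 1, u₃ - 1, k + 1 - (u₂ + u₃)] i := by
    intro U₂ U₃ h
    obtain ⟨A₂, s2, d2⟩ := exists_sup_eq_finrank_add (inf_le_left : U₂ ⊓ U₃ ≤ U₂)
    obtain ⟨A₃, s3, d3⟩ := exists_sup_eq_finrank_add (inf_le_right : U₂ ⊓ U₃ ≤ U₃)
    obtain ⟨A₄, s4, d4⟩ := exists_sup_eq_finrank_add (le_top : U₂ ⊔ U₃ ≤ ⊤)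
    have hs := h.finrank_sup
    rw [finrank_top, finrank_fin_fun] at d4
    rw [h.finrank_inf, h.finrank_two] at d2
    rw [h.finrank_inf, h.finrank_three] at d3
    refine ⟨![U₂ ⊓ U₃, A₂, A₃, A₄], s2, s3, ?_, ?_, ?_⟩
    · rw [eq_top_iff, ← s4]
      refine sup_le (sup_le ?_ ?_) (le_iSup ![U₂ ⊓ U₃, A₂, A₃, A₄] 3)
      · exact s2.symm.le.trans (sup_le (le_iSup ![U₂ ⊓ U₃, A₂, A₃, A₄] 0)
          (le_iSup ![U₂ ⊓ U₃, A₂, A₃, A₄] 1))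
      · exact s3.symm.le.trans (sup_le (le_iSup ![U₂ ⊓ U₃, A₂, A₃, A₄] 0)
          (le_iSup ![U₂ ⊓ U₃, A₂, A₃, A₄] 2))
    · rw [Fin.sum_univ_four]
      change finrank F (U₂ ⊓ U₃ : Submodule F (Fin k → F)) + finrank F A₂ + finrank F A₃
        + finrank F A₄ = k
      have := h.finrank_inf
      omega
    · have e1 := h.finrank_inf
      have e2 : finrank F A₂ = u₂ - 1 := by omega
      have e3 : finrank F A₃ = u₃ - 1 := by omega
      have e4 : finrank F A₄ = k + 1 - (u₂ + u₃) := by omega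
      intro i
      fin_cases i
      exacts [e1, e2, e3, e4]
  obtain ⟨A, a2, a3, at', ad, af⟩ := key hU
  obtain ⟨B, b2, b3, bt, -, bf⟩ := key hW
  obtain ⟨e, he⟩ := exists_linearEquiv_map_eq A B at' bt (by rw [ad, finrank_fin_fun])
    fun i => (af i).trans (bf i).symm
  refine ⟨e, ?_, ?_⟩
  · rw [← a2, ← b2, Submodule.map_sup, he, he]
  · rw [← a3, ← b3, Submodule.map_sup, he, he]

theorem M_map (e : (Fin k → F) ≃ₗ[F] (Fin k → F)) (U₂ U₃ : Submodule F (Fin k → F))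
    (v₁ v₂ v₃ m : ℕ) :
    M (U₂.map e.toLinearMap) (U₃.map e.toLinearMap) v₁ v₂ v₃ m = M U₂ U₃ v₁ v₂ v₃ m := by
  have hinj : Function.Injective (Submodule.map e.toLinearMap) :=
    Submodule.map_injective_of_injective e.injective
  rw [M, M, ← Set.ncard_image_of_injective {V : Submodule F (Fin k → F) | finrank F V = m ∧
    finrank F (U₂ ⊓ U₃ ⊓ V : Submodule F (Fin k → F)) = v₁ ∧
    finrank F (U₂ ⊓ V : Submodule F (Fin k → F)) = v₂ ∧
    finrank F (U₃ ⊓ V : Submodule F (Fin k → F)) = v₃} hinj]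
  have hmap : ∀ A B : Submodule F (Fin k → F),
      (A ⊓ B).map e.toLinearMap = A.map e.toLinearMap ⊓ B.map e.toLinearMap :=
    fun _ _ => Submodule.map_inf _ e.injective
  have hfin : ∀ A : Submodule F (Fin k → F), finrank F (A.map e.toLinearMap) = finrank F A :=
    e.finrank_map_eq
  congr 1
  ext V
  simp only [Set.mem_ofPred_eq, Set.mem_image]
  constructor
  · intro h
    have hV : (V.comap e.toLinearMap).map e.toLinearMap = V :=
      Submodule.map_comap_eq_of_surjective e.surjective V
    refine ⟨V.comap e.toLinearMap, ?_, hV⟩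
    rw [← hV] at h
    rw [← hmap, ← hmap, ← hmap, ← hmap, hfin, hfin, hfin, hfin] at h
    exact h
  · rintro ⟨V, h, rfl⟩
    rw [← hmap, ← hmap, ← hmap, ← hmap, hfin, hfin, hfin, hfin]
    exact h

theorem IsPair.M_eq {U₂ U₃ W₂ W₃ : Submodule F (Fin k → F)}
    (hU : IsPair u₂ u₃ U₂ U₃) (hW : IsPair u₂ u₃ W₂ W₃) (v₁ v₂ v₃ m : ℕ) :
    M W₂ W₃ v₁ v₂ v₃ m = M U₂ U₃ v₁ v₂ v₃ m := by
  obtain ⟨e, rfl, rfl⟩ := hU.exists_linearEquiv hW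
  exact M_map e U₂ U₃ v₁ v₂ v₃ m

end Pairs

/-- With exponents from `u₂, u₃, k` this gives `d > 0`; with `k - u₃ + 1, k - u₂ + 1, k` it gives
`A_d > 0`. -/
theorem pow_sub_one_add_pow_sub_one_lt {q a b c : ℕ} (hq : 2 ≤ q) (ha : 1 ≤ a) (hab : a < b)
    (hbc : b < c) : q ^ (a - 1) + q ^ (b - 1) < q ^ (c - 1) := by
  have h1 : q ^ (a - 1) < q ^ (b - 1) := Nat.pow_lt_pow_right (by omega) (by omega)
  calc q ^ (a - 1) + q ^ (b - 1) < 2 * q ^ (b - 1) := by omega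
    _ ≤ q * q ^ (b - 1) := Nat.mul_le_mul_right _ hq
    _ = q ^ (b - 1 + 1) := by rw [pow_succ, mul_comm]
    _ ≤ q ^ (c - 1) := Nat.pow_le_pow_right (by omega) (by omega)

/-! ### Weight distribution and minimum distance. -/

section Weights

variable {F : Type*} [Field F] [DecidableEq F] {k n u₂ u₃ : ℕ}
  {U₂ U₃ : Submodule F (Fin k → F)} {G : Matrix (Fin k) (Fin n) F}

theorem minDist_eq_sInf_hammingNorm (C : Submodule F (Fin n → F)) :
    minDist C = sInf {d | ∃ c ∈ C, c ≠ 0 ∧ hammingNorm c = d} := by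
  rw [minDist]
  congr 1
  ext d
  simp only [Set.mem_ofPred_eq]
  constructor
  · rintro ⟨x, hx, y, hy, hxy, h⟩
    exact ⟨-x + y, C.add_mem (C.neg_mem hx) hy, fun h0 => hxy (neg_add_eq_zero.1 h0),
      by rw [← hammingDist_eq_hammingNorm, h]⟩
  · rintro ⟨c, hc, h0, h⟩
    exact ⟨c, hc, 0, C.zero_mem, h0, by rw [hammingDist_zero_right, h]⟩

theorem minDist_le_hammingNorm {C : Submodule F (Fin n → F)} {c : Fin n → F} (hc : c ∈ C)
    (h0 : c ≠ 0) : minDist C ≤ hammingNorm c := by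
  rw [minDist_eq_sInf_hammingNorm]
  exact Nat.sInf_le ⟨c, hc, h0, rfl⟩

theorem weightCount_rowCode (hinj : Function.Injective G.vecMulLinear) (j : ℕ) :
    weightCount (rowCode G) j = {y | hammingNorm (G.vecMulLinear y) = j}.ncard := by
  rw [weightCount, ← Set.ncard_image_of_injective _ hinj, rowCode_eq_range]
  congr 1
  ext c
  simp only [LinearMap.mem_range, Set.mem_ofPred_eq, Set.mem_image]
  constructor
  · rintro ⟨⟨y, rfl⟩, h⟩
    exact ⟨y, h, rfl⟩
  · rintro ⟨y, h, rfl⟩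
    exact ⟨⟨y, rfl⟩, h⟩

theorem weightCount_zero (C : Submodule F (Fin n → F)) : weightCount C 0 = 1 := by
  rw [weightCount, Set.ncard_eq_one]
  refine ⟨0, ?_⟩
  ext c
  simp only [Set.mem_ofPred_eq, hammingNorm_eq_zero, Set.mem_singleton_iff]
  exact ⟨fun h => h.2, fun h => ⟨h ▸ C.zero_mem, h⟩⟩

theorem le_length_of_weightCount_ne_zero {C : Submodule F (Fin n → F)} {j : ℕ}
    (h : weightCount C j ≠ 0) : j ≤ n := by
  obtain ⟨c, -, rfl⟩ := Set.nonempty_of_ncard_ne_zero h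
  simpa using hammingNorm_le_card_fintype (x := c)

theorem isWeightCode_of_support {C : Submodule F (Fin n → F)} {t : ℕ} (s : Finset ℕ)
    (hs : s.card = t) (h0 : 0 ∉ s) (hne : ∀ j ∈ s, weightCount C j ≠ 0)
    (hz : ∀ j, j ≠ 0 → j ∉ s → weightCount C j = 0) : IsWeightCode C t := by
  have : {j : ℕ | 1 ≤ j ∧ j ≤ n ∧ weightCount C j ≠ 0} = s := by
    ext j
    simp only [Set.mem_ofPred_eq, Finset.mem_coe]
    constructor
    · rintro ⟨h1, -, h2⟩
      by_contra hj
      exact h2 (hz j (by omega) hj)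
    · intro hj
      refine ⟨?_, le_length_of_weightCount_ne_zero (hne j hj), hne j hj⟩
      rcases Nat.eq_zero_or_pos j with rfl | h
      · exact absurd hj h0
      · exact h
  rw [IsWeightCode, this, Set.ncard_coe_finset, hs]

variable [Fintype F]

/-- The weight of a codeword `yG`, according to which of the orthogonal complements of `U₂`, `U₃`
and `U₂ ∩ U₃` contain `y`. -/
theorem IsComplementMatrix.hammingNorm_cases (hG : IsComplementMatrix U₂ U₃ G)
    (hU : IsPair u₂ u₃ U₂ U₃) {d : ℕ}
    (hd : (d : ℤ) = (Fintype.card F : ℤ) ^ (k - 1) - (Fintype.card F : ℤ) ^ (u₂ - 1)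
      - (Fintype.card F : ℤ) ^ (u₃ - 1)) {y : Fin k → F} (hy : y ≠ 0) :
    (y ∉ dotOrth (U₂ ⊓ U₃) ∧ y ∉ dotOrth U₂ ∧ y ∉ dotOrth U₃ ∧
      hammingNorm (G.vecMulLinear y) = d + 1) ∨
    (y ∈ dotOrth (U₂ ⊓ U₃) ∧ y ∉ dotOrth U₂ ∧ y ∉ dotOrth U₃ ∧
      hammingNorm (G.vecMulLinear y) = d) ∨
    (y ∈ dotOrth (U₂ ⊓ U₃) ∧ y ∈ dotOrth U₂ ∧ y ∉ dotOrth U₃ ∧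
      hammingNorm (G.vecMulLinear y) = d + Fintype.card F ^ (u₂ - 1)) ∨
    (y ∈ dotOrth (U₂ ⊓ U₃) ∧ y ∉ dotOrth U₂ ∧ y ∈ dotOrth U₃ ∧
      hammingNorm (G.vecMulLinear y) = d + Fintype.card F ^ (u₃ - 1)) ∨
    (y ∈ dotOrth (U₂ ⊓ U₃) ∧ y ∈ dotOrth U₂ ∧ y ∈ dotOrth U₃ ∧
      hammingNorm (G.vecMulLinear y)
        = d + Fintype.card F ^ (u₂ - 1) + Fintype.card F ^ (u₃ - 1)) := by
  classical
  have hw := hG.hammingNorm_vecMul hU hy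
  have h2 : y ∈ dotOrth U₂ → y ∈ dotOrth (U₂ ⊓ U₃) := fun h => dotOrth_le_dotOrth inf_le_left h
  have h3 : y ∈ dotOrth U₃ → y ∈ dotOrth (U₂ ⊓ U₃) := fun h => dotOrth_le_dotOrth inf_le_right h
  zify
  rw [hd, hw]
  by_cases m1 : y ∈ dotOrth (U₂ ⊓ U₃) <;> by_cases m2 : y ∈ dotOrth U₂ <;>
    by_cases m3 : y ∈ dotOrth U₃ <;> simp only [m1, m2, m3, if_true, if_false] <;> simp <;>
    first | tauto | ring

/-- Every possible weight of `yG` with `y ≠ 0` is at least `d`, and `d` is positive. -/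
theorem IsComplementMatrix.vecMul_injective (hG : IsComplementMatrix U₂ U₃ G)
    (hU : IsPair u₂ u₃ U₂ U₃) (hu₂ : 1 < u₂) (hu₂₃ : u₂ < u₃) (hu₃ : u₃ < k) :
    Function.Injective G.vecMulLinear := by
  have hlt := pow_sub_one_add_pow_sub_one_lt (Fintype.one_lt_card (α := F)) hu₂.le hu₂₃ hu₃
  refine (injective_iff_map_eq_zero _).2 fun y h0 => ?_
  by_contra hy
  have hc := hG.hammingNorm_cases hU (d := Fintype.card F ^ (k - 1) - Fintype.card F ^ (u₂ - 1)
      - Fintype.card F ^ (u₃ - 1)) (by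
    rw [Nat.sub_sub]
    push_cast [Nat.cast_sub hlt.le]
    ring) hy
  rw [h0, hammingNorm_zero] at hc
  omega

theorem IsComplementMatrix.finrank_rowCode (hG : IsComplementMatrix U₂ U₃ G)
    (hU : IsPair u₂ u₃ U₂ U₃) (hu₂ : 1 < u₂) (hu₂₃ : u₂ < u₃) (hu₃ : u₃ < k) :
    finrank F (rowCode G) = k := by
  rw [rowCode_eq_range, LinearMap.finrank_range_of_inj (hG.vecMul_injective hU hu₂ hu₂₃ hu₃),
    finrank_fin_fun]

/-- The weight distribution of the code generated by a complement matrix. -/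
theorem IsComplementMatrix.weightCount_eq (hG : IsComplementMatrix U₂ U₃ G)
    (hU : IsPair u₂ u₃ U₂ U₃) (hu₂ : 1 < u₂) (hu₂₃ : u₂ < u₃) (hu₃ : u₃ < k)
    (hsum : u₂ + u₃ ≤ k + 1) {q : ℕ} (hq : Fintype.card F = q) {d : ℕ}
    (hd : (d : ℤ) = (q : ℤ) ^ (k - 1) - (q : ℤ) ^ (u₂ - 1) - (q : ℤ) ^ (u₃ - 1)) :
    (weightCount (rowCode G) d : ℤ)
      = (q : ℤ) ^ (k - 1) - (q : ℤ) ^ (k - u₂) - (q : ℤ) ^ (k - u₃)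
        + (q : ℤ) ^ (k + 1 - u₂ - u₃) ∧
    (weightCount (rowCode G) (d + 1) : ℤ) = (q : ℤ) ^ k - (q : ℤ) ^ (k - 1) ∧
    (weightCount (rowCode G) (d + q ^ (u₂ - 1)) : ℤ)
      = (q : ℤ) ^ (k - u₂) - (q : ℤ) ^ (k + 1 - u₂ - u₃) ∧
    (weightCount (rowCode G) (d + q ^ (u₃ - 1)) : ℤ)
      = (q : ℤ) ^ (k - u₃) - (q : ℤ) ^ (k + 1 - u₂ - u₃) ∧
    (weightCount (rowCode G) (d + q ^ (u₂ - 1) + q ^ (u₃ - 1)) : ℤ)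
      = (q : ℤ) ^ (k + 1 - u₂ - u₃) - 1 ∧
    ∀ j : ℕ, j ∉ ({0, d, d + 1, d + q ^ (u₂ - 1), d + q ^ (u₃ - 1),
        d + q ^ (u₂ - 1) + q ^ (u₃ - 1)} : Set ℕ) → weightCount (rowCode G) j = 0 := by
  subst hq
  have hlt := pow_sub_one_add_pow_sub_one_lt (Fintype.one_lt_card (α := F)) hu₂.le hu₂₃ hu₃
  -- This separates `d + 1` from `d + q^(u₂-1)` and is where `u₂ > 1` enters; with the next
  -- inequality all five weights are distinct, so each weight is one class of `y`.
  have ha : 2 ≤ Fintype.card F ^ (u₂ - 1) :=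
    Fintype.one_lt_card.trans_le (Nat.le_self_pow (by omega) _)
  have hab : Fintype.card F ^ (u₂ - 1) < Fintype.card F ^ (u₃ - 1) :=
    Nat.pow_lt_pow_right Fintype.one_lt_card (by omega)
  have hdpos : 0 < d := by
    zify at hlt ⊢
    linarith
  have hinj := hG.vecMul_injective hU hu₂ hu₂₃ hu₃
  have h0 : ∀ y, hammingNorm (G.vecMulLinear y) = 0 ↔ y = 0 := fun y => by
    rw [hammingNorm_eq_zero, map_eq_zero_iff _ hinj]
  have hcases := fun y (hy : y ≠ 0) => hG.hammingNorm_cases hU hd hy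
  have hz : ∀ A : Submodule F (Fin k → F), (0 : Fin k → F) ∈ dotOrth A :=
    fun A => Submodule.zero_mem _
  have f1 : finrank F (dotOrth (U₂ ⊓ U₃)) = k - 1 := by rw [finrank_dotOrth, hU.finrank_inf]
  have f2 : finrank F (dotOrth U₂) = k - u₂ := by rw [finrank_dotOrth, hU.finrank_two]
  have f3 : finrank F (dotOrth U₃) = k - u₃ := by rw [finrank_dotOrth, hU.finrank_three]
  -- This is the orthogonal complement of `U₂ ⊔ U₃`, which has dimension `u₂ + u₃ - 1`.
  have f23 : finrank F (dotOrth U₂ ⊓ dotOrth U₃ : Submodule F (Fin k → F))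
      = k + 1 - u₂ - u₃ := by
    have := hU.finrank_sup
    rw [← dotOrth_sup, finrank_dotOrth]
    omega
  have i2 : dotOrth U₂ ⊓ dotOrth (U₂ ⊓ U₃) = dotOrth U₂ :=
    inf_eq_left.2 (dotOrth_le_dotOrth inf_le_left)
  have i3 : dotOrth U₃ ⊓ dotOrth (U₂ ⊓ U₃) = dotOrth U₃ :=
    inf_eq_left.2 (dotOrth_le_dotOrth inf_le_right)
  have i23 : dotOrth U₂ ⊓ dotOrth U₃ ⊓ dotOrth (U₂ ⊓ U₃) = dotOrth U₂ ⊓ dotOrth U₃ :=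
    inf_eq_left.2 (inf_le_left.trans (dotOrth_le_dotOrth inf_le_left))
  set a := Fintype.card F ^ (u₂ - 1) with ha_def
  set b := Fintype.card F ^ (u₃ - 1) with hb_def
  have hsplit : ∀ A B : Submodule F (Fin k → F), ({y | y ∈ A ∧ y ∉ B}.ncard : ℤ)
      = (Fintype.card F : ℤ) ^ finrank F A
        - (Fintype.card F : ℤ) ^ finrank F (B ⊓ A : Submodule F (Fin k → F)) := by
    intro A B
    have := ncard_mem_notMem_notMem A B B
    rw [inf_idem] at this
    simp only [and_self] at this
    linarith
  refine ⟨?_, ?_, ?_, ?_, ?_, ?_⟩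
  · rw [weightCount_rowCode hinj]
    have hs : {y | hammingNorm (G.vecMulLinear y) = d}
        = {y | y ∈ dotOrth (U₂ ⊓ U₃) ∧ y ∉ dotOrth U₂ ∧ y ∉ dotOrth U₃} := by
      ext y
      simp only [Set.mem_ofPred_eq]
      by_cases hy : y = 0
      · have := (h0 y).2 hy
        subst hy
        simp only [hz, not_true, and_false, iff_false]
        omega
      · rcases hcases y hy with h | h | h | h | h <;>
          simp only [h, not_true, not_false_eq_true, and_true, and_false, iff_false] <;> omega
    rw [hs, ncard_mem_notMem_notMem, i2, i3, i23, f1, f2, f3, f23]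
  · rw [weightCount_rowCode hinj]
    have hs : {y | hammingNorm (G.vecMulLinear y) = d + 1}
        = {y | y ∈ (⊤ : Submodule F (Fin k → F)) ∧ y ∉ dotOrth (U₂ ⊓ U₃)} := by
      ext y
      simp only [Set.mem_ofPred_eq, Submodule.mem_top, true_and]
      by_cases hy : y = 0
      · have := (h0 y).2 hy
        subst hy
        simp only [hz, not_true, iff_false]
        omega
      · rcases hcases y hy with h | h | h | h | h <;>
          simp only [h, not_true, not_false_eq_true, iff_false] <;> omega
    rw [hs, hsplit, inf_top_eq, finrank_top, finrank_fin_fun, f1]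
  · rw [weightCount_rowCode hinj]
    have hs : {y | hammingNorm (G.vecMulLinear y) = d + a}
        = {y | y ∈ dotOrth U₂ ∧ y ∉ dotOrth U₃} := by
      ext y
      simp only [Set.mem_ofPred_eq]
      by_cases hy : y = 0
      · have := (h0 y).2 hy
        subst hy
        simp only [hz, not_true, and_false, iff_false]
        omega
      · rcases hcases y hy with h | h | h | h | h <;>
          simp only [h, not_true, not_false_eq_true, and_true, and_false, iff_false] <;> omega
    rw [hs, hsplit, inf_comm, f2, f23]
  · rw [weightCount_rowCode hinj]
    have hs : {y | hammingNorm (G.vecMulLinear y) = d + b}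
        = {y | y ∈ dotOrth U₃ ∧ y ∉ dotOrth U₂} := by
      ext y
      simp only [Set.mem_ofPred_eq]
      by_cases hy : y = 0
      · have := (h0 y).2 hy
        subst hy
        simp only [hz, not_true, and_false, iff_false]
        omega
      · rcases hcases y hy with h | h | h | h | h <;>
          simp only [h, not_true, not_false_eq_true, and_true, and_false, iff_false] <;> omega
    rw [hs, hsplit, f3, f23]
  · rw [weightCount_rowCode hinj]
    have hs : {y | hammingNorm (G.vecMulLinear y) = d + a + b}
        = {y | y ∈ dotOrth U₂ ⊓ dotOrth U₃ ∧ y ∉ (⊥ : Submodule F (Fin k → F))} := by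
      ext y
      simp only [Set.mem_ofPred_eq, Submodule.mem_inf, Submodule.mem_bot]
      by_cases hy : y = 0
      · have := (h0 y).2 hy
        subst hy
        simp only [not_true, and_false, iff_false]
        omega
      · rcases hcases y hy with h | h | h | h | h <;>
          simp only [h, hy, not_false_eq_true, and_true, and_false, iff_false] <;> omega
    rw [hs, hsplit, bot_inf_eq, finrank_bot, pow_zero, f23]
  · intro j hj
    simp only [Set.mem_insert_iff, Set.mem_singleton_iff, not_or] at hj
    rw [weightCount_rowCode hinj, Set.ncard_eq_zero]
    ext y
    simp only [Set.mem_ofPred_eq, Set.mem_empty_iff_false, iff_false]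
    by_cases hy : y = 0
    · have := (h0 y).2 hy
      omega
    · rcases hcases y hy with h | h | h | h | h <;> omega

theorem IsComplementMatrix.minDist_eq (hG : IsComplementMatrix U₂ U₃ G)
    (hU : IsPair u₂ u₃ U₂ U₃) (hu₂ : 1 < u₂) (hu₂₃ : u₂ < u₃) (hu₃ : u₃ < k)
    (hsum : u₂ + u₃ ≤ k + 1) {q : ℕ} (hq : Fintype.card F = q) {d : ℕ}
    (hd : (d : ℤ) = (q : ℤ) ^ (k - 1) - (q : ℤ) ^ (u₂ - 1) - (q : ℤ) ^ (u₃ - 1)) :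
    minDist (rowCode G) = d := by
  have hA := (hG.weightCount_eq hU hu₂ hu₂₃ hu₃ hsum hq hd).1
  subst hq
  have hlt := pow_sub_one_add_pow_sub_one_lt (Fintype.one_lt_card (α := F)) hu₂.le hu₂₃ hu₃
  have hlt' := pow_sub_one_add_pow_sub_one_lt (Fintype.one_lt_card (α := F))
    (show 1 ≤ k - u₃ + 1 by omega) (show k - u₃ + 1 < k - u₂ + 1 by omega)
    (show k - u₂ + 1 < k by omega)
  simp only [Nat.add_sub_cancel] at hlt'
  have hne : weightCount (rowCode G) d ≠ 0 := by
    have : (0 : ℤ) ≤ (Fintype.card F : ℤ) ^ (k + 1 - u₂ - u₃) := by positivity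
    zify at hlt' ⊢
    rw [hA]
    linarith
  have hdpos : 0 < d := by
    zify at hlt ⊢
    linarith
  rw [minDist_eq_sInf_hammingNorm]
  refine IsLeast.csInf_eq ⟨?_, ?_⟩
  · obtain ⟨c, hc, hcd⟩ := Set.nonempty_of_ncard_ne_zero hne
    refine ⟨c, hc, ?_, hcd⟩
    rintro rfl
    rw [hammingNorm_zero] at hcd
    omega
  · rintro _ ⟨c, hc, h0, rfl⟩
    rw [rowCode_eq_range] at hc
    obtain ⟨y, rfl⟩ := hc
    have hy : y ≠ 0 := by
      rintro rfl
      exact h0 (map_zero _)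
    rcases hG.hammingNorm_cases hU hd hy with h | h | h | h | h <;> omega

theorem IsComplementMatrix.isWeightCode (hG : IsComplementMatrix U₂ U₃ G)
    (hU : IsPair u₂ u₃ U₂ U₃) (hu₂ : 1 < u₂) (hu₂₃ : u₂ < u₃) (hu₃ : u₃ < k)
    (hsum : u₂ + u₃ ≤ k + 1) {q : ℕ} (hq : Fintype.card F = q) {d : ℕ}
    (hd : (d : ℤ) = (q : ℤ) ^ (k - 1) - (q : ℤ) ^ (u₂ - 1) - (q : ℤ) ^ (u₃ - 1)) :
    (u₂ + u₃ < k + 1 → IsWeightCode (rowCode G) 5) ∧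
      (u₂ + u₃ = k + 1 → IsWeightCode (rowCode G) 4) := by
  obtain ⟨w0, w1, w2, w3, w23, wz⟩ := hG.weightCount_eq hU hu₂ hu₂₃ hu₃ hsum hq hd
  have hq2 : 2 ≤ q := hq ▸ Fintype.one_lt_card
  have hlt := pow_sub_one_add_pow_sub_one_lt hq2 hu₂.le hu₂₃ hu₃
  have hlt' := pow_sub_one_add_pow_sub_one_lt hq2
    (show 1 ≤ k - u₃ + 1 by omega) (show k - u₃ + 1 < k - u₂ + 1 by omega)
    (show k - u₂ + 1 < k by omega)
  simp only [Nat.add_sub_cancel] at hlt'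
  have ha : 2 ≤ q ^ (u₂ - 1) := hq2.trans (Nat.le_self_pow (by omega) _)
  have hab : q ^ (u₂ - 1) < q ^ (u₃ - 1) := Nat.pow_lt_pow_right hq2 (by omega)
  have p1 : q ^ (k - 1) < q ^ k := Nat.pow_lt_pow_right hq2 (by omega)
  have p2 : q ^ (k + 1 - u₂ - u₃) < q ^ (k - u₂) := Nat.pow_lt_pow_right hq2 (by omega)
  have p3 : q ^ (k + 1 - u₂ - u₃) < q ^ (k - u₃) := Nat.pow_lt_pow_right hq2 (by omega)
  have hdpos : 0 < d := by
    zify at hlt ⊢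
    linarith
  zify at hlt' p1 p2 p3
  have n0 : weightCount (rowCode G) d ≠ 0 := by
    have : (0 : ℤ) ≤ (q : ℤ) ^ (k + 1 - u₂ - u₃) := by positivity
    zify
    rw [w0]
    linarith
  have n1 : weightCount (rowCode G) (d + 1) ≠ 0 := by
    zify
    rw [w1]
    linarith
  have n2 : weightCount (rowCode G) (d + q ^ (u₂ - 1)) ≠ 0 := by
    zify
    rw [w2]
    linarith
  have n3 : weightCount (rowCode G) (d + q ^ (u₃ - 1)) ≠ 0 := by
    zify
    rw [w3]
    linarith
  set a := q ^ (u₂ - 1)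
  set b := q ^ (u₃ - 1)
  constructor
  · intro h
    have p4 : q ^ 0 < q ^ (k + 1 - u₂ - u₃) := Nat.pow_lt_pow_right hq2 (by omega)
    rw [pow_zero] at p4
    have n23 : weightCount (rowCode G) (d + a + b) ≠ 0 := by
      zify at p4 ⊢
      rw [w23]
      linarith
    refine isWeightCode_of_support {d, d + 1, d + a, d + b, d + a + b} ?_ ?_ ?_ ?_
    · iterate 4 rw [Finset.card_insert_of_notMem (by
        simp only [Finset.mem_insert, Finset.mem_singleton]
        omega)]
      rfl
    · simp only [Finset.mem_insert, Finset.mem_singleton]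
      omega
    · intro j hj
      simp only [Finset.mem_insert, Finset.mem_singleton] at hj
      rcases hj with rfl | rfl | rfl | rfl | rfl <;> assumption
    · intro j hj0 hj
      refine wz j ?_
      simp only [Finset.mem_insert, Finset.mem_singleton] at hj
      simp only [Set.mem_insert_iff, Set.mem_singleton_iff]
      tauto
  · intro h
    -- Here `U₂ ⊔ U₃` is the whole space, so no nonzero `y` is orthogonal to both and the top weight
    -- disappears.
    rw [show k + 1 - u₂ - u₃ = 0 by omega, pow_zero, sub_self] at w23
    refine isWeightCode_of_support {d, d + 1, d + a, d + b} ?_ ?_ ?_ ?_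
    · iterate 3 rw [Finset.card_insert_of_notMem (by
        simp only [Finset.mem_insert, Finset.mem_singleton]
        omega)]
      rfl
    · simp only [Finset.mem_insert, Finset.mem_singleton]
      omega
    · intro j hj
      simp only [Finset.mem_insert, Finset.mem_singleton] at hj
      rcases hj with rfl | rfl | rfl | rfl <;> assumption
    · intro j hj0 hj
      by_cases hj' : j = d + a + b
      · rw [hj']
        exact_mod_cast w23
      refine wz j ?_
      simp only [Finset.mem_insert, Finset.mem_singleton] at hj
      simp only [Set.mem_insert_iff, Set.mem_singleton_iff]
      tauto

end Weights

/-! ### Generalized Hamming weights and support weight distributions. -/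

section Subcodes

variable {F : Type*} [Field F] {k n u₂ u₃ : ℕ}
  {U₂ U₃ : Submodule F (Fin k → F)} {G : Matrix (Fin k) (Fin n) F}

/-- The dimensions of the intersections of a pair with an arbitrary subspace. -/
theorem IsPair.inter_bounds (hU : IsPair u₂ u₃ U₂ U₃) {r : ℕ} {V : Submodule F (Fin k → F)}
    (hr : r ≤ k) (hV : finrank F V = k - r) {v₁ v₂ v₃ : ℕ}
    (h₁ : finrank F (U₂ ⊓ U₃ ⊓ V : Submodule F (Fin k → F)) = v₁)
    (h₂ : finrank F (U₂ ⊓ V : Submodule F (Fin k → F)) = v₂)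
    (h₃ : finrank F (U₃ ⊓ V : Submodule F (Fin k → F)) = v₃) :
    (1 ≤ v₁ + r ∧ v₁ ≤ 1 ∧ v₁ ≤ k - r) ∧ (u₂ ≤ v₂ + r ∧ v₂ ≤ u₂ ∧ v₂ ≤ k - r) ∧
      (u₃ ≤ v₃ + r ∧ v₃ ≤ u₃ ∧ v₃ ≤ k - r) ∧ (v₁ ≤ v₂ ∧ v₂ + 1 ≤ u₂ + v₁) ∧
      (v₁ ≤ v₃ ∧ v₃ + 1 ≤ u₃ + v₁) ∧ v₂ + v₃ ≤ k - r + v₁ := by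
  have hA : ∀ A : Submodule F (Fin k → F),
      finrank F A ≤ finrank F (A ⊓ V : Submodule F (Fin k → F)) + r := by
    intro A
    have e := Submodule.finrank_sup_add_finrank_inf_eq A V
    have l := Submodule.finrank_le (A ⊔ V)
    rw [finrank_fin_fun] at l
    omega
  -- The dimension formula is applied three times: to `U₂ ∩ V` and `U₂ ∩ U₃` inside `U₂`, likewise
  -- inside `U₃`, and to `U₂ ∩ V` and `U₃ ∩ V` inside `V`. All three pairs meet in `U₂ ∩ U₃ ∩ V`.
  have hm : ∀ A B C D : Submodule F (Fin k → F), A ⊔ B ≤ C → A ⊓ B = D →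
      finrank F A + finrank F B ≤ finrank F C + finrank F D := by
    rintro A B C D hC rfl
    rw [← Submodule.finrank_sup_add_finrank_inf_eq A B]
    exact Nat.add_le_add_right (Submodule.finrank_mono hC) _
  have a1 := hA (U₂ ⊓ U₃)
  have a2 := hA U₂
  have a3 := hA U₃
  have b1 := Submodule.finrank_mono (inf_le_left : U₂ ⊓ U₃ ⊓ V ≤ U₂ ⊓ U₃)
  have b1' := Submodule.finrank_mono (inf_le_right : U₂ ⊓ U₃ ⊓ V ≤ V)
  have b2 := Submodule.finrank_mono (inf_le_left : U₂ ⊓ V ≤ U₂)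
  have b2' := Submodule.finrank_mono (inf_le_right : U₂ ⊓ V ≤ V)
  have b3 := Submodule.finrank_mono (inf_le_left : U₃ ⊓ V ≤ U₃)
  have b3' := Submodule.finrank_mono (inf_le_right : U₃ ⊓ V ≤ V)
  have c2 := Submodule.finrank_mono (inf_le_inf_right V inf_le_left : U₂ ⊓ U₃ ⊓ V ≤ U₂ ⊓ V)
  have c3 := Submodule.finrank_mono (inf_le_inf_right V inf_le_right : U₂ ⊓ U₃ ⊓ V ≤ U₃ ⊓ V)
  have m2 := hm (U₂ ⊓ V) (U₂ ⊓ U₃) U₂ (U₂ ⊓ U₃ ⊓ V) (sup_le inf_le_left inf_le_left) (by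
    rw [← inf_inf_distrib_left, inf_comm V, ← inf_assoc])
  have m3 := hm (U₃ ⊓ V) (U₂ ⊓ U₃) U₃ (U₂ ⊓ U₃ ⊓ V) (sup_le inf_le_left inf_le_right) (by
    rw [inf_comm U₂, ← inf_inf_distrib_left, inf_comm V, ← inf_assoc])
  have m23 := hm (U₂ ⊓ V) (U₃ ⊓ V) V (U₂ ⊓ U₃ ⊓ V) (sup_le inf_le_right inf_le_right)
    (inf_inf_distrib_right U₂ U₃ V).symm
  rw [hU.finrank_inf] at a1 b1 m2 m3
  rw [hU.finrank_two] at a2 b2 m2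
  rw [hU.finrank_three] at a3 b3 m3
  omega

theorem finrank_map_of_injective {K V W : Type*} [Field K] [AddCommGroup V] [Module K V]
    [AddCommGroup W] [Module K W] {f : V →ₗ[K] W} (hf : Function.Injective f)
    (p : Submodule K V) : finrank K (p.map f) = finrank K p :=
  (Submodule.equivMapOfInjective f hf p).finrank_eq.symm

/-- Subcodes of dimension `r` correspond to subspaces of `F^k` of codimension `r`. -/
theorem exists_subcode_iff (hinj : Function.Injective G.vecMulLinear) {r w : ℕ} (hr : r ≤ k) :
    (∃ U : Submodule F (Fin n → F), U ≤ rowCode G ∧ finrank F U = r ∧ suppWeight U = w) ↔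
      ∃ V : Submodule F (Fin k → F), finrank F V = k - r ∧ w + colCount G V = n := by
  constructor
  · rintro ⟨U, hU, rfl, rfl⟩
    rw [rowCode_eq_range] at hU
    have hD : (U.comap G.vecMulLinear).map G.vecMulLinear = U := Submodule.map_comap_eq_of_le hU
    refine ⟨dotOrth (U.comap G.vecMulLinear), ?_, ?_⟩
    · conv_rhs => rw [← hD]
      rw [finrank_dotOrth, finrank_map_of_injective hinj]
    · have := suppWeight_map_add_colCount G (U.comap G.vecMulLinear)
      rwa [hD] at this
  · rintro ⟨V, hV, hw⟩
    refine ⟨(dotOrth V).map G.vecMulLinear, ?_, ?_, ?_⟩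
    · rw [rowCode_eq_range]
      exact LinearMap.map_le_range
    · rw [finrank_map_of_injective hinj, finrank_dotOrth, hV]
      omega
    · have := suppWeight_map_add_colCount G (dotOrth V)
      rw [dotOrth_dotOrth] at this
      omega

/-- Complementation is an involution and `y ↦ yG` is injective, so sending `V` to the image of `V^⊥`
is a bijection onto the subcodes. -/
theorem subcodeCount_rowCode (hinj : Function.Injective G.vecMulLinear) {r j : ℕ} (hr : r ≤ k) :
    subcodeCount (rowCode G) r j
      = {V : Submodule F (Fin k → F) | finrank F V = k - r ∧ j + colCount G V = n}.ncard := by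
  have hinj' : Function.Injective
      fun V : Submodule F (Fin k → F) => (dotOrth V).map G.vecMulLinear := fun V W h => by
    rw [← dotOrth_dotOrth V, ← dotOrth_dotOrth W, Submodule.map_injective_of_injective hinj h]
  rw [subcodeCount, ← Set.ncard_image_of_injective _ hinj']
  congr 1
  ext U
  simp only [Set.mem_ofPred_eq, Set.mem_image]
  constructor
  · rintro ⟨hU, rfl, rfl⟩
    rw [rowCode_eq_range] at hU
    have hD : (U.comap G.vecMulLinear).map G.vecMulLinear = U := Submodule.map_comap_eq_of_le hU
    refine ⟨dotOrth (U.comap G.vecMulLinear), ⟨?_, ?_⟩, ?_⟩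
    · conv_rhs => rw [← hD]
      rw [finrank_dotOrth, finrank_map_of_injective hinj]
    · have := suppWeight_map_add_colCount G (U.comap G.vecMulLinear)
      rwa [hD] at this
    · rw [dotOrth_dotOrth, hD]
  · rintro ⟨V, ⟨hV, hw⟩, rfl⟩
    refine ⟨?_, ?_, ?_⟩
    · rw [rowCode_eq_range]
      exact LinearMap.map_le_range
    · rw [finrank_map_of_injective hinj, finrank_dotOrth, hV]
      omega
    · have := suppWeight_map_add_colCount G (dotOrth V)
      rw [dotOrth_dotOrth] at this
      omega

/-- The truncated difference covers both cases of general position: `V` and `A` span the space, or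
they meet trivially. -/
theorem finrank_inf_of_finrank_sup {A V : Submodule F (Fin k → F)} {r : ℕ} (hr : r ≤ k)
    (hV : finrank F V = k - r)
    (h : finrank F (V ⊔ A : Submodule F (Fin k → F)) = min k (finrank F A + (k - r))) :
    finrank F (A ⊓ V : Submodule F (Fin k → F)) = finrank F A - r := by
  have := Submodule.finrank_sup_add_finrank_inf_eq V A
  rw [inf_comm]
  omega

theorem IsPair.exists_generic (hU : IsPair u₂ u₃ U₂ U₃) {r : ℕ} (hr : r ≤ k) (hur : u₂ ≤ r) :
    ∃ V : Submodule F (Fin k → F), finrank F V = k - r ∧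
      finrank F (U₂ ⊓ U₃ ⊓ V : Submodule F (Fin k → F)) = 0 ∧
      finrank F (U₂ ⊓ V : Submodule F (Fin k → F)) = 0 ∧
      finrank F (U₃ ⊓ V : Submodule F (Fin k → F)) = u₃ - r := by
  obtain ⟨V, -, hd, h2, h3⟩ := exists_le_finrank_sup_eq_min
    (⊥ : Submodule F (Fin k → F)) U₂ U₃ (k - r) (by rw [finrank_fin_fun, finrank_bot]; omega)
  rw [bot_sup_eq, finrank_fin_fun] at h2 h3
  rw [finrank_bot, zero_add] at hd
  have i2 := finrank_inf_of_finrank_sup hr hd h2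
  have i3 := finrank_inf_of_finrank_sup hr hd h3
  rw [hU.finrank_two] at i2
  rw [hU.finrank_three] at i3
  obtain ⟨-, -, -, ⟨h12, -⟩, -⟩ := hU.inter_bounds hr hd rfl rfl rfl
  exact ⟨V, hd, by omega, by omega, i3⟩

variable [Fintype F]

/-- The number of columns outside a subspace `V`, in terms of the dimensions of the
intersections of `V` with the pair. -/
theorem IsComplementMatrix.length_sub_colCount (hG : IsComplementMatrix U₂ U₃ G)
    (hU : IsPair u₂ u₃ U₂ U₃) (V : Submodule F (Fin k → F)) :
    ((Fintype.card F : ℤ) - 1) * (n - colCount G V)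
      = (Fintype.card F : ℤ) ^ k - (Fintype.card F : ℤ) ^ u₂ - (Fintype.card F : ℤ) ^ u₃
        + Fintype.card F - (Fintype.card F : ℤ) ^ finrank F V
        + (Fintype.card F : ℤ) ^ finrank F (U₂ ⊓ V : Submodule F (Fin k → F))
        + (Fintype.card F : ℤ) ^ finrank F (U₃ ⊓ V : Submodule F (Fin k → F))
        - (Fintype.card F : ℤ) ^ finrank F (U₂ ⊓ U₃ ⊓ V : Submodule F (Fin k → F)) := by
  rw [mul_sub, hG.colCount_eq, hG.length_eq hU]
  ring

/-- For fixed `r` the support weight increases with `q^v₂ + q^v₃ - q^v₁`. Thus a lower bound `m`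
over the numerically admissible triples, attained by one actual `V`, determines `d_r`. -/
theorem IsComplementMatrix.ghw_eq (hG : IsComplementMatrix U₂ U₃ G)
    (hU : IsPair u₂ u₃ U₂ U₃) (hinj : Function.Injective G.vecMulLinear) {r : ℕ} (hr : r ≤ k)
    {m : ℤ}
    (hmin : ∀ v₁ v₂ v₃, u₂ ≤ v₂ + r → u₃ ≤ v₃ + r → v₁ ≤ 1 → v₁ ≤ v₂ → v₁ ≤ v₃ →
      m ≤ (Fintype.card F : ℤ) ^ v₂ + (Fintype.card F : ℤ) ^ v₃ - (Fintype.card F : ℤ) ^ v₁)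
    (V : Submodule F (Fin k → F)) (hV : finrank F V = k - r)
    (hm : m = (Fintype.card F : ℤ) ^ finrank F (U₂ ⊓ V : Submodule F (Fin k → F))
        + (Fintype.card F : ℤ) ^ finrank F (U₃ ⊓ V : Submodule F (Fin k → F))
        - (Fintype.card F : ℤ) ^ finrank F (U₂ ⊓ U₃ ⊓ V : Submodule F (Fin k → F))) :
    ((Fintype.card F : ℤ) - 1) * ghw (rowCode G) r
      = (Fintype.card F : ℤ) ^ k - (Fintype.card F : ℤ) ^ u₂ - (Fintype.card F : ℤ) ^ u₃
        + Fintype.card F - (Fintype.card F : ℤ) ^ (k - r) + m := by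
  have hq : (1 : ℤ) < Fintype.card F := by exact_mod_cast Fintype.one_lt_card
  have hle : ∀ W : Submodule F (Fin k → F), colCount G W ≤ n := fun W => by
    have := suppWeight_map_add_colCount G (dotOrth W)
    rw [dotOrth_dotOrth] at this
    omega
  have hghw : ghw (rowCode G) r = n - colCount G V := by
    rw [ghw]
    refine IsLeast.csInf_eq ⟨?_, ?_⟩
    · refine (exists_subcode_iff hinj hr).2 ⟨V, hV, ?_⟩
      have := hle V
      omega
    · intro w hw
      obtain ⟨W, hW, hwW⟩ := (exists_subcode_iff hinj hr).1 hw
      obtain ⟨⟨-, h1, -⟩, ⟨h2, -⟩, ⟨h3, -⟩, ⟨h12, -⟩, ⟨h13, -⟩, -⟩ :=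
        hU.inter_bounds hr hW rfl rfl rfl
      have hm' := hmin _ _ _ h2 h3 h1 h12 h13
      have eV := hG.length_sub_colCount hU V
      have eW := hG.length_sub_colCount hU W
      rw [hV] at eV
      rw [hW] at eW
      have : ((Fintype.card F : ℤ) - 1) * (n - colCount G V)
          ≤ ((Fintype.card F : ℤ) - 1) * (n - colCount G W) := by linarith
      have := le_of_mul_le_mul_left this (by linarith)
      omega
  rw [hghw, Nat.cast_sub (hle V), hG.length_sub_colCount hU, hV, hm]
  ring

/-- The minimum wants `v₁` large and `v₂`, `v₃` small. As `r < u₂`, a `V` through `U₂ ∩ U₃` and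
otherwise generic achieves `v₁ = 1` together with the least values `u₂ - r` and `u₃ - r`. -/
theorem IsComplementMatrix.ghw_of_lt (hG : IsComplementMatrix U₂ U₃ G)
    (hU : IsPair u₂ u₃ U₂ U₃) (hinj : Function.Injective G.vecMulLinear) (hu₂₃ : u₂ < u₃)
    (hu₃ : u₃ < k) {r : ℕ} (hr : r < u₂) :
    ((Fintype.card F : ℤ) - 1) * ghw (rowCode G) r
      = (Fintype.card F : ℤ) ^ k - (Fintype.card F : ℤ) ^ u₂ - (Fintype.card F : ℤ) ^ u₃
        - (Fintype.card F : ℤ) ^ (k - r) + (Fintype.card F : ℤ) ^ (u₂ - r)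
        + (Fintype.card F : ℤ) ^ (u₃ - r) := by
  have hq : (1 : ℤ) ≤ Fintype.card F := by exact_mod_cast Fintype.card_pos
  obtain ⟨V, hle, hd, h2, h3⟩ := exists_le_finrank_sup_eq_min (U₂ ⊓ U₃) U₂ U₃ (k - r - 1)
    (by rw [finrank_fin_fun, hU.finrank_inf]; omega)
  rw [sup_eq_right.2 (inf_le_left : U₂ ⊓ U₃ ≤ U₂), finrank_fin_fun, hU.finrank_two] at h2
  rw [sup_eq_right.2 (inf_le_right : U₂ ⊓ U₃ ≤ U₃), finrank_fin_fun, hU.finrank_three] at h3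
  rw [hU.finrank_inf] at hd
  have e2 := Submodule.finrank_sup_add_finrank_inf_eq V U₂
  have e3 := Submodule.finrank_sup_add_finrank_inf_eq V U₃
  rw [hU.finrank_two, inf_comm] at e2
  rw [hU.finrank_three, inf_comm] at e3
  have := hG.ghw_eq hU hinj (r := r) (by omega)
    (m := (Fintype.card F : ℤ) ^ (u₂ - r) + (Fintype.card F : ℤ) ^ (u₃ - r) - Fintype.card F)
    (fun v₁ v₂ v₃ h2 h3 h1 _ _ => by
      have l1 := pow_le_pow_right₀ hq h1
      have l2 := pow_le_pow_right₀ hq (show u₂ - r ≤ v₂ by omega)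
      have l3 := pow_le_pow_right₀ hq (show u₃ - r ≤ v₃ by omega)
      rw [pow_one] at l1
      linarith) V (by omega) (by
      rw [inf_eq_left.2 hle, hU.finrank_inf,
        show finrank F (U₂ ⊓ V : Submodule F (Fin k → F)) = u₂ - r by omega,
        show finrank F (U₃ ⊓ V : Submodule F (Fin k → F)) = u₃ - r by omega, pow_one])
  rw [this]
  ring

/-- Since `v₁ ≤ v₂`, the first and last powers contribute at least zero, and a generic `V` has `v₁ =
v₂ = 0`. For `r ≥ u₃` the truncated exponent makes the last term `1`. -/
theorem IsComplementMatrix.ghw_of_le (hG : IsComplementMatrix U₂ U₃ G)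
    (hU : IsPair u₂ u₃ U₂ U₃) (hinj : Function.Injective G.vecMulLinear) {r : ℕ} (hr : r ≤ k)
    (hur : u₂ ≤ r) :
    ((Fintype.card F : ℤ) - 1) * ghw (rowCode G) r
      = (Fintype.card F : ℤ) ^ k - (Fintype.card F : ℤ) ^ u₂ - (Fintype.card F : ℤ) ^ u₃
        + Fintype.card F - (Fintype.card F : ℤ) ^ (k - r)
        + (Fintype.card F : ℤ) ^ (u₃ - r) := by
  have hq : (1 : ℤ) ≤ Fintype.card F := by exact_mod_cast Fintype.card_pos
  obtain ⟨V, hV, h1, h2, h3⟩ := hU.exists_generic hr hur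
  exact hG.ghw_eq hU hinj hr
    (fun v₁ v₂ v₃ _ h3 _ h12 _ => by
      have l1 := pow_le_pow_right₀ hq h12
      have l3 := pow_le_pow_right₀ hq (show u₃ - r ≤ v₃ by omega)
      linarith) V hV (by rw [h1, h2, h3]; ring)

/-- The subcode support weight distribution. -/
theorem IsComplementMatrix.subcodeCount_eq (hG : IsComplementMatrix U₂ U₃ G)
    (hU : IsPair u₂ u₃ U₂ U₃) (hinj : Function.Injective G.vecMulLinear) {q : ℕ}
    (hq : Fintype.card F = q) {r : ℕ} (hr : r ≤ k) (j : ℕ) :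
    subcodeCount (rowCode G) r j
      = ∑ v ∈ Z q k u₂ u₃ r j, M U₂ U₃ v.1 v.2.1 v.2.2 (k - r) := by
  classical
  subst hq
  have hq : (1 : ℚ) < Fintype.card F := by exact_mod_cast Fintype.one_lt_card
  have : Finite (Submodule F (Fin k → F)) :=
    Finite.of_injective (fun V => (V : Set (Fin k → F))) SetLike.coe_injective
  have := Fintype.ofFinite (Submodule F (Fin k → F))
  let f : Submodule F (Fin k → F) → ℕ × ℕ × ℕ := fun V =>
    (finrank F (U₂ ⊓ U₃ ⊓ V : Submodule F (Fin k → F)),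
      finrank F (U₂ ⊓ V : Submodule F (Fin k → F)), finrank F (U₃ ⊓ V : Submodule F (Fin k → F)))
  have hiff : ∀ V : Submodule F (Fin k → F), finrank F V = k - r →
      (j + colCount G V = n ↔ mNumber (Fintype.card F) k u₂ u₃ r j =
        ((Fintype.card F : ℚ) ^ (f V).2.1 - 1) / ((Fintype.card F : ℚ) - 1)
          + ((Fintype.card F : ℚ) ^ (f V).2.2 - 1) / ((Fintype.card F : ℚ) - 1)
          - ((Fintype.card F : ℚ) ^ (f V).1 - 1) / ((Fintype.card F : ℚ) - 1)) := by
    intro V hV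
    have e := hG.length_sub_colCount hU V
    rw [hV] at e
    have e' : ((Fintype.card F : ℚ) - 1) * (n - colCount G V)
      = (Fintype.card F : ℚ) ^ k - (Fintype.card F : ℚ) ^ u₂ - (Fintype.card F : ℚ) ^ u₃
        + Fintype.card F - (Fintype.card F : ℚ) ^ (k - r)
        + (Fintype.card F : ℚ) ^ (f V).2.1 + (Fintype.card F : ℚ) ^ (f V).2.2
        - (Fintype.card F : ℚ) ^ (f V).1 := by exact_mod_cast e
    have hq' : (Fintype.card F : ℚ) - 1 ≠ 0 := by linarith
    have hj : j + colCount G V = n ↔ (j : ℚ) = n - colCount G V := by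
      rw [eq_sub_iff_add_eq]
      exact_mod_cast Iff.rfl
    rw [hj, ← mul_right_inj' hq', e', mNumber, ← mul_right_inj' hq']
    field_simp
    constructor <;> intro h <;> linarith
  have hS : {V : Submodule F (Fin k → F) | finrank F V = k - r ∧ j + colCount G V = n}
      = (Finset.univ.filter fun V : Submodule F (Fin k → F) =>
          finrank F V = k - r ∧ j + colCount G V = n : Finset _) := by
    ext V
    simp
  rw [subcodeCount_rowCode hinj hr, hS, Set.ncard_coe_finset,
    Finset.card_eq_sum_card_fiberwise (f := f) (t := Z (Fintype.card F) k u₂ u₃ r j)]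
  · refine Finset.sum_congr rfl fun v hv => ?_
    rw [M, ← Set.ncard_coe_finset]
    congr 1
    ext V
    simp only [Finset.coe_filter, Finset.mem_filter, Finset.mem_univ, true_and,
      Set.mem_ofPred_eq]
    constructor
    · rintro ⟨⟨hV, -⟩, rfl⟩
      exact ⟨hV, rfl, rfl, rfl⟩
    · rintro ⟨hV, h1, h2, h3⟩
      have hf : f V = v := by
        simp only [f, h1, h2, h3]
      refine ⟨⟨hV, (hiff V hV).2 ?_⟩, hf⟩
      rw [hf]
      exact (Finset.mem_filter.1 hv).2.2.2.2.2.2.2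
  -- The inequalities defining `Z` hold for every `V` of codimension `r`, so the fibres over `Z`
  -- miss nothing; triples realized by no `V` contribute zero.
  · intro V hV
    obtain ⟨hV, hjV⟩ := (Finset.mem_filter.1 (Finset.mem_coe.1 hV)).2
    obtain ⟨h1, h2, h3, h12, h13, h23⟩ := hU.inter_bounds hr hV rfl rfl rfl
    refine Finset.mem_coe.2 (Finset.mem_filter.2 ⟨?_, ?_, ?_, ?_, ?_, ?_, ?_, (hiff V hV).1 hjV⟩)
    · simp only [Finset.mem_product, Finset.mem_range, f]
      omega
    all_goals
      simp only [f]
      omega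

end Subcodes

/-! ### The Griesmer bound and evaluation of Griesmer sums. -/

section Griesmer

variable {F : Type*} [Field F] [Fintype F]

/-- The Griesmer bound, for the restriction of a code to a set `S` of coordinates. -/
theorem griesmer_bound {ι : Type*} [Finite ι] [DecidableEq F] (k : ℕ) :
    ∀ (C : Submodule F (ι → F)) (S : Finset ι) (d : ℕ), finrank F C = k →
      (∀ c ∈ C, c ≠ 0 → d ≤ (S.filter fun i => c i ≠ 0).card) →
      ∑ i ∈ Finset.range k, ⌈(d : ℚ) / (Fintype.card F : ℚ) ^ i⌉₊ ≤ S.card := by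
  classical
  have := Fintype.ofFinite ι
  induction k with
  | zero => simp
  | succ k ih =>
    intro C S d hC hd
    have hne : (Finset.univ.filter fun c : ι → F => c ∈ C ∧ c ≠ 0).Nonempty := by
      have : C ≠ ⊥ := by
        rintro rfl
        simp at hC
      obtain ⟨c, hc, h0⟩ := C.exists_mem_ne_zero_of_ne_bot this
      exact ⟨c, by simp [hc, h0]⟩
    -- The induction passes to the residual code of a word of least weight on `S`: a complement `D`
    -- of that word in `C`, viewed on its zero positions.
    obtain ⟨c₀, hc₀, hmin⟩ := Finset.exists_min_image _
      (fun c : ι → F => (S.filter fun i => c i ≠ 0).card) hne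
    simp only [Finset.mem_filter, Finset.mem_univ, true_and] at hc₀ hmin
    obtain ⟨hc₀C, hc₀⟩ := hc₀
    set w := (S.filter fun i => c₀ i ≠ 0).card with hw
    have hdw : d ≤ w := hd c₀ hc₀C hc₀
    have hle : Submodule.span F {c₀} ≤ C := (Submodule.span_singleton_le_iff_mem _ _).2 hc₀C
    obtain ⟨D, hD, hDf⟩ := exists_sup_eq_finrank_add hle
    have hdisj : Submodule.span F {c₀} ⊓ D = ⊥ := by
      have := Submodule.finrank_sup_add_finrank_inf_eq (Submodule.span F {c₀}) D
      rw [hD] at this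
      exact Submodule.finrank_eq_zero.1 (by omega)
    rw [finrank_span_singleton hc₀] at hDf
    have hDC : D ≤ C := hD ▸ le_sup_right
    have hqpos : (0 : ℚ) < Fintype.card F := by exact_mod_cast Fintype.card_pos
    have hres : ∀ c ∈ D, c ≠ 0 →
        ⌈(w : ℚ) / Fintype.card F⌉₊
          ≤ ((S.filter fun i => c₀ i = 0).filter fun i => c i ≠ 0).card := by
      intro c hc hc0
      have hge : ∀ a : F, w ≤ (S.filter fun i => (c + a • c₀) i ≠ 0).card := by
        intro a
        refine hmin _ ⟨C.add_mem (hDC hc) (C.smul_mem a hc₀C), fun h => hc0 ?_⟩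
        have hm : c ∈ Submodule.span F {c₀} ⊓ D :=
          ⟨by
            rw [eq_neg_of_add_eq_zero_left h]
            exact Submodule.neg_mem _ (Submodule.smul_mem _ a (Submodule.mem_span_singleton_self _)),
            hc⟩
        rwa [hdisj, Submodule.mem_bot] at hm
      -- The weights of `c + a • c₀` are summed over all `a`. A position with `c₀ i ≠ 0` is killed
      -- by exactly one `a`; one with `c₀ i = 0` counts `q` times or never. As each weight is at
      -- least `w`, the residual weight is at least `w / q`.
      have hsum : ∑ a : F, (S.filter fun i => (c + a • c₀) i ≠ 0).card
          = Fintype.card F * ((S.filter fun i => c₀ i = 0).filter fun i => c i ≠ 0).card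
            + (Fintype.card F - 1) * w := by
        simp only [Finset.card_filter]
        rw [Finset.sum_comm, ← Finset.sum_filter_add_sum_filter_not S fun i => c₀ i = 0]
        congr 1
        · rw [Finset.mul_sum]
          refine Finset.sum_congr rfl fun i hi => ?_
          simp [(Finset.mem_filter.1 hi).2]
        · rw [hw, Finset.card_eq_sum_ones, Finset.mul_sum]
          refine Finset.sum_congr rfl fun i hi => ?_
          have hi0 : c₀ i ≠ 0 := (Finset.mem_filter.1 hi).2
          rw [← Finset.card_filter, mul_one]
          have : (Finset.univ.filter fun a : F => (c + a • c₀) i ≠ 0)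
              = Finset.univ.erase (-c i / c₀ i) := by
            ext a
            simp only [Finset.mem_filter, Finset.mem_univ, true_and, Finset.mem_erase, and_true,
              Pi.add_apply, Pi.smul_apply, smul_eq_mul, ne_eq, eq_div_iff hi0]
            rw [add_comm, add_eq_zero_iff_eq_neg]
          rw [this, Finset.card_erase_of_mem (Finset.mem_univ _), Finset.card_univ]
      have hsumge : Fintype.card F * w ≤ ∑ a : F, (S.filter fun i => (c + a • c₀) i ≠ 0).card := by
        rw [← smul_eq_mul, ← Finset.card_univ, ← Finset.sum_const]
        exact Finset.sum_le_sum fun a _ => hge a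
      rw [hsum] at hsumge
      have hq1 : Fintype.card F * w = w + (Fintype.card F - 1) * w := by
        obtain ⟨m, hm⟩ : ∃ m, Fintype.card F = m + 1 :=
          ⟨Fintype.card F - 1, by have := Fintype.card_pos (α := F); omega⟩
        rw [hm, Nat.add_sub_cancel]
        ring
      rw [Nat.ceil_le, div_le_iff₀ hqpos, mul_comm]
      exact_mod_cast (by omega : w ≤ Fintype.card F *
        ((S.filter fun i => c₀ i = 0).filter fun i => c i ≠ 0).card)
    have hih := ih D (S.filter fun i => c₀ i = 0) _ (by omega) hres
    have hS : S.card = (S.filter fun i => c₀ i = 0).card + w := by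
      rw [hw, Finset.card_filter_add_card_filter_not]
    rw [Finset.sum_range_succ', hS]
    refine add_le_add (le_trans (Finset.sum_le_sum fun i _ => ?_) hih) (by simpa using hdw)
    refine Nat.ceil_mono ?_
    rw [pow_succ', ← div_div]
    refine div_le_div_of_nonneg_right (le_trans ?_ (Nat.le_ceil _)) (by positivity)
    exact div_le_div_of_nonneg_right (by exact_mod_cast hdw) hqpos.le

/-- The `i`-th term of the Griesmer sum of `(q ^ K - q ^ a - q ^ b) / q`. -/
def griesmerTerm (q K a b i : ℕ) : ℤ :=
  (if i < K then (q : ℤ) ^ (K - 1 - i) else 0) - (if i < a then (q : ℤ) ^ (a - 1 - i) else 0)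
    - (if i < b then (q : ℤ) ^ (b - 1 - i) else 0)

theorem sub_one_mul_sum_ite_pow (q K a : ℕ) (h : a ≤ K) :
    ((q : ℤ) - 1) * ∑ i ∈ Finset.range K, (if i < a then (q : ℤ) ^ (a - 1 - i) else 0)
      = (q : ℤ) ^ a - 1 := by
  rw [← Finset.sum_filter]
  have : (Finset.range K).filter (· < a) = Finset.range a := by
    ext i
    simp only [Finset.mem_filter, Finset.mem_range]
    omega
  rw [this, Finset.sum_range_reflect (fun i => (q : ℤ) ^ i) a, mul_geom_sum]

theorem sub_one_mul_sum_griesmerTerm {q K a b : ℕ} (ha : a ≤ K) (hb : b ≤ K) :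
    ((q : ℤ) - 1) * ∑ i ∈ Finset.range K, griesmerTerm q K a b i
      = (q : ℤ) ^ K - (q : ℤ) ^ a - (q : ℤ) ^ b + 1 := by
  simp only [griesmerTerm, Finset.sum_sub_distrib, mul_sub,
    sub_one_mul_sum_ite_pow q K _ le_rfl, sub_one_mul_sum_ite_pow q K _ ha,
    sub_one_mul_sum_ite_pow q K _ hb]
  ring

/-- Powers with exponent above `i` divide exactly. The remaining negative part is less than
`q^(i+1)` in size, because `a < b ≤ i` gives `q^a + q^b < q^(b+1)`, and `ε ≤ q^a` cannot make it
positive. -/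
theorem ceil_eq_griesmerTerm {q K a b i : ℕ} (hq : 2 ≤ q) (hab : a < b)
    (hi : i < K) {ε : ℚ} (hε : ε = 0 ∨ a = 0 ∧ 0 ≤ ε ∧ ε ≤ 1) :
    ⌈((q : ℚ) ^ K - (q : ℚ) ^ a - (q : ℚ) ^ b + ε) / (q : ℚ) ^ (i + 1)⌉
      = griesmerTerm q K a b i := by
  have hq' : (2 : ℚ) ≤ q := by exact_mod_cast hq
  have hQ : (0 : ℚ) < (q : ℚ) ^ (i + 1) := by positivity
  have hsplit : ∀ m, i < m → (q : ℚ) ^ m = (q : ℚ) ^ (m - 1 - i) * (q : ℚ) ^ (i + 1) := by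
    intro m hm
    rw [← pow_add]
    congr 1
    omega
  have ha0 : (0 : ℚ) < (q : ℚ) ^ a := by positivity
  have hb0 : (0 : ℚ) < (q : ℚ) ^ b := by positivity
  have hεa : 0 ≤ ε ∧ ε ≤ (q : ℚ) ^ a := by
    rcases hε with rfl | ⟨rfl, h0, h1⟩
    · exact ⟨le_rfl, ha0.le⟩
    · exact ⟨h0, by simpa using h1⟩
  rw [Int.ceil_eq_iff, lt_div_iff₀ hQ, div_le_iff₀ hQ, griesmerTerm, if_pos hi]
  rw [hsplit K hi]
  by_cases h1 : i < a
  · have h2 : i < b := h1.trans hab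
    have : ε = 0 := by
      rcases hε with h | ⟨h, -⟩
      · exact h
      · omega
    rw [if_pos h1, if_pos h2, this, hsplit a h1, hsplit b h2]
    push_cast
    constructor <;> nlinarith
  · have hle : (q : ℚ) ^ a < (q : ℚ) ^ (i + 1) := pow_lt_pow_right₀ (by linarith) (by omega)
    rw [if_neg h1]
    by_cases h2 : i < b
    · rw [if_pos h2, hsplit b h2]
      push_cast
      constructor <;> nlinarith
    · have hle2 : (q : ℚ) ^ a < (q : ℚ) ^ b := pow_lt_pow_right₀ (by linarith) hab
      have hle3 : (q : ℚ) ^ (b + 1) ≤ (q : ℚ) ^ (i + 1) :=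
        pow_le_pow_right₀ (by linarith) (by omega)
      have hle4 : 2 * (q : ℚ) ^ b ≤ (q : ℚ) ^ (b + 1) := by
        rw [pow_succ']
        exact mul_le_mul_of_nonneg_right hq' hb0.le
      rw [if_neg h2]
      push_cast
      constructor <;> nlinarith

/-- For `i < a` the quotient without `ε` is an integer, so any positive `ε` pushes the ceiling past
it. -/
theorem griesmerTerm_add_le_ceil {q K a b i : ℕ} (hq : 2 ≤ q) (hab : a < b)
    (hi : i < K) {ε : ℚ} (hε : 0 < ε) :
    griesmerTerm q K a b i + (if i < a then 1 else 0)
      ≤ ⌈((q : ℚ) ^ K - (q : ℚ) ^ a - (q : ℚ) ^ b + ε) / (q : ℚ) ^ (i + 1)⌉ := by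
  have hQ : (0 : ℚ) < (q : ℚ) ^ (i + 1) := by positivity
  rw [← ceil_eq_griesmerTerm hq hab hi (Or.inl rfl)]
  split_ifs with h
  · rw [Int.add_one_le_iff, Int.lt_ceil, ceil_eq_griesmerTerm hq hab hi (Or.inl rfl)]
    rw [lt_div_iff₀ hQ, griesmerTerm, if_pos hi, if_pos h, if_pos (h.trans hab)]
    have hsplit : ∀ m, i < m → (q : ℚ) ^ m = (q : ℚ) ^ (m - 1 - i) * (q : ℚ) ^ (i + 1) := by
      intro m hm
      rw [← pow_add]
      congr 1
      omega
    rw [hsplit K hi, hsplit a h, hsplit b (h.trans hab)]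
    push_cast
    linarith
  · rw [add_zero]
    exact Int.ceil_mono (div_le_div_of_nonneg_right (by linarith) hQ.le)

/-- The factor `q^r - 1` cancels in every summand, leaving a Griesmer sum with `K = k - r`. -/
theorem sub_one_mul_griesmerDefect {n k r a b : ℕ} {C : Submodule F (Fin n → F)}
    (hC : finrank F C = k) (hr : 1 ≤ r) (hab : a < b) (hb : b ≤ k - r) {ε : ℚ}
    (hε : ε = 0 ∨ a = 0 ∧ 0 ≤ ε ∧ ε ≤ 1)
    (hg : ((Fintype.card F : ℚ) - 1) * ghw C r
      = ((Fintype.card F : ℚ) ^ r - 1) * ((Fintype.card F : ℚ) ^ (k - r)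
        - (Fintype.card F : ℚ) ^ a - (Fintype.card F : ℚ) ^ b + ε)) :
    ((Fintype.card F : ℤ) - 1) * griesmerDefect C r
      = ((Fintype.card F : ℤ) - 1) * n - ((Fintype.card F : ℤ) - 1) * ghw C r
        - ((Fintype.card F : ℤ) ^ (k - r) - (Fintype.card F : ℤ) ^ a
          - (Fintype.card F : ℤ) ^ b + 1) := by
  have hq : 2 ≤ Fintype.card F := Fintype.one_lt_card
  have hq' : (1 : ℚ) < (Fintype.card F : ℚ) ^ r :=
    one_lt_pow₀ (by exact_mod_cast Fintype.one_lt_card) (by omega)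
  rw [griesmerDefect, mul_sub, mul_sub, ← sub_one_mul_sum_griesmerTerm (hab.le.trans hb) hb, hC,
    ← Finset.Ico_add_one_right_eq_Icc, Finset.sum_Ico_eq_sum_range, Nat.add_sub_cancel]
  congr 2
  refine Finset.sum_congr rfl fun i hi => ?_
  rw [← ceil_eq_griesmerTerm hq hab (Finset.mem_range.1 hi) hε, hg, add_comm 1 i,
    mul_comm ((Fintype.card F : ℚ) ^ (i + 1)), mul_div_mul_left _ _ (by linarith)]

end Griesmer

/-! ### Griesmer defects and distance-optimality. -/

section Optimality

variable {F : Type*} [Field F] [Fintype F] {k n u₂ u₃ : ℕ}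
  {U₂ U₃ : Submodule F (Fin k → F)} {G : Matrix (Fin k) (Fin n) F}

/-- Here `(q - 1) d_r` factors exactly, with exponents `u₂ - r`, `u₃ - r` and `ε = 0`. The defect
comes from the term `+ q` in the length, due to the point shared by `U₂` and `U₃`. -/
theorem IsComplementMatrix.griesmerDefect_of_lt (hG : IsComplementMatrix U₂ U₃ G)
    (hU : IsPair u₂ u₃ U₂ U₃) (hu₂ : 1 < u₂) (hu₂₃ : u₂ < u₃) (hu₃ : u₃ < k) {r : ℕ}
    (hr : 1 ≤ r) (hru : r < u₂) : griesmerDefect (rowCode G) r = 1 := by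
  classical
  have hq : (1 : ℤ) < Fintype.card F := by exact_mod_cast Fintype.one_lt_card
  have hg := hG.ghw_of_lt hU (hG.vecMul_injective hU hu₂ hu₂₃ hu₃) hu₂₃ hu₃ hru
  have hsplit : ∀ m, r ≤ m → (Fintype.card F : ℚ) ^ m
      = (Fintype.card F : ℚ) ^ r * (Fintype.card F : ℚ) ^ (m - r) := fun m hm => by
    rw [← pow_add, Nat.add_sub_cancel' hm]
  have hd := sub_one_mul_griesmerDefect (hG.finrank_rowCode hU hu₂ hu₂₃ hu₃) hr
    (show u₂ - r < u₃ - r by omega) (by omega) (Or.inl rfl) (by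
      have hg' : ((Fintype.card F : ℚ) - 1) * ghw (rowCode G) r
          = (Fintype.card F : ℚ) ^ k - (Fintype.card F : ℚ) ^ u₂ - (Fintype.card F : ℚ) ^ u₃
          - (Fintype.card F : ℚ) ^ (k - r) + (Fintype.card F : ℚ) ^ (u₂ - r)
          + (Fintype.card F : ℚ) ^ (u₃ - r) := by exact_mod_cast hg
      rw [hg', hsplit k (by omega), hsplit u₂ (by omega), hsplit u₃ (by omega)]
      ring)
  rw [hg, hG.length_eq hU] at hd
  refine mul_left_cancel₀ (sub_ne_zero.2 hq.ne') (hd.trans ?_)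
  ring

theorem IsComplementMatrix.griesmerDefect_eq_zero (hG : IsComplementMatrix U₂ U₃ G)
    (hU : IsPair u₂ u₃ U₂ U₃) (hu₂ : 1 < u₂) (hu₂₃ : u₂ < u₃) (hu₃ : u₃ < k) :
    griesmerDefect (rowCode G) u₂ = 0 := by
  classical
  have hq : (1 : ℤ) < Fintype.card F := by exact_mod_cast Fintype.one_lt_card
  have hqQ : (1 : ℚ) < Fintype.card F := by exact_mod_cast Fintype.one_lt_card
  have hg := hG.ghw_of_le hU (hG.vecMul_injective hU hu₂ hu₂₃ hu₃) (by omega) (le_refl u₂)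
  have hsplit : ∀ m, u₂ ≤ m → (Fintype.card F : ℚ) ^ m
      = (Fintype.card F : ℚ) ^ u₂ * (Fintype.card F : ℚ) ^ (m - u₂) := fun m hm => by
    rw [← pow_add, Nat.add_sub_cancel' hm]
  have hqr : (Fintype.card F : ℚ) ≤ (Fintype.card F : ℚ) ^ u₂ :=
    le_self_pow₀ hqQ.le (by omega)
  have hqr' : (0 : ℚ) < (Fintype.card F : ℚ) ^ u₂ - 1 := by linarith
  -- At `r = u₂` the lower exponent is `0` and the factorization by `q^u₂ - 1` leaves the remainder
  -- `q - 1`, whence this `ε`.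
  have hd := sub_one_mul_griesmerDefect (hG.finrank_rowCode hU hu₂ hu₂₃ hu₃) hu₂.le
    (show 0 < u₃ - u₂ by omega) (by omega)
    (ε := ((Fintype.card F : ℚ) - 1) / ((Fintype.card F : ℚ) ^ u₂ - 1))
    (Or.inr ⟨rfl, div_nonneg (by linarith) hqr'.le, (div_le_one hqr').2 (by linarith)⟩) (by
      have hg' : ((Fintype.card F : ℚ) - 1) * ghw (rowCode G) u₂
          = (Fintype.card F : ℚ) ^ k - (Fintype.card F : ℚ) ^ u₂ - (Fintype.card F : ℚ) ^ u₃
          + Fintype.card F - (Fintype.card F : ℚ) ^ (k - u₂)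
          + (Fintype.card F : ℚ) ^ (u₃ - u₂) := by exact_mod_cast hg
      rw [hg', mul_add, mul_div_cancel₀ _ hqr'.ne', hsplit k (by omega), hsplit u₃ (by omega)]
      ring)
  rw [hg, hG.length_eq hU] at hd
  refine mul_left_cancel₀ (sub_ne_zero.2 hq.ne') (hd.trans ?_)
  ring

/-- The Griesmer sum of `d` is `n - 1`, and for `d + 1` each of the first `u₂` terms grows by at
least one. A better code would need length at least `n - 1 + u₂ > n`. -/
theorem IsComplementMatrix.isDistanceOptimal [DecidableEq F] (hG : IsComplementMatrix U₂ U₃ G)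
    (hU : IsPair u₂ u₃ U₂ U₃) (hu₂ : 1 < u₂) (hu₂₃ : u₂ < u₃) (hu₃ : u₃ < k) {d : ℕ}
    (hd : (d : ℤ) = (Fintype.card F : ℤ) ^ (k - 1) - (Fintype.card F : ℤ) ^ (u₂ - 1)
      - (Fintype.card F : ℤ) ^ (u₃ - 1)) (hmin : minDist (rowCode G) = d) :
    IsDistanceOptimal (rowCode G) := by
  rintro ⟨C', hC', hlt⟩
  rw [hG.finrank_rowCode hU hu₂ hu₂₃ hu₃] at hC'
  rw [hmin] at hlt
  have hq : 2 ≤ Fintype.card F := Fintype.one_lt_card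
  have hq1 : (1 : ℤ) < Fintype.card F := by exact_mod_cast Fintype.one_lt_card
  have hq0 : (0 : ℚ) < Fintype.card F := by exact_mod_cast Fintype.card_pos
  have hb := griesmer_bound k C' Finset.univ (d + 1) hC' fun c hc h0 =>
    (Nat.succ_le_of_lt hlt).trans (minDist_le_hammingNorm hc h0)
  rw [Finset.card_univ, Fintype.card_fin] at hb
  have hterm : ∀ i ∈ Finset.range k,
      griesmerTerm (Fintype.card F) k u₂ u₃ i + (if i < u₂ then 1 else 0)
        ≤ (⌈((d + 1 : ℕ) : ℚ) / (Fintype.card F : ℚ) ^ i⌉₊ : ℤ) := by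
    intro i hi
    -- Numerator and denominator of `(d + 1) / q^i` are multiplied by `q`, so the added `1` becomes
    -- `ε = q`.
    have h := griesmerTerm_add_le_ceil hq hu₂₃ (Finset.mem_range.1 hi) hq0
    have hd' : (d : ℚ) = (Fintype.card F : ℚ) ^ (k - 1) - (Fintype.card F : ℚ) ^ (u₂ - 1)
      - (Fintype.card F : ℚ) ^ (u₃ - 1) := by exact_mod_cast hd
    have he : ∀ m, 1 ≤ m → (Fintype.card F : ℚ) ^ m
        = (Fintype.card F : ℚ) ^ (m - 1) * Fintype.card F := fun m hm => by
      rw [← pow_succ, Nat.sub_add_cancel hm]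
    have hdiv : ((d + 1 : ℕ) : ℚ) / (Fintype.card F : ℚ) ^ i
        = ((Fintype.card F : ℚ) ^ k - (Fintype.card F : ℚ) ^ u₂ - (Fintype.card F : ℚ) ^ u₃
          + Fintype.card F) / (Fintype.card F : ℚ) ^ (i + 1) := by
      rw [Nat.cast_add, Nat.cast_one, hd', he k (by omega), he u₂ (by omega), he u₃ (by omega),
        pow_succ, ← mul_div_mul_right _ _ hq0.ne']
      congr 1
      ring
    rw [Int.natCast_ceil_eq_ceil (by positivity), hdiv]
    exact h
  have hsum := Finset.sum_le_sum hterm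
  have hu : ∑ i ∈ Finset.range k, (if i < u₂ then (1 : ℤ) else 0) = u₂ := by
    rw [← Finset.sum_filter, show (Finset.range k).filter (· < u₂) = Finset.range u₂ by
      ext i
      simp only [Finset.mem_filter, Finset.mem_range]
      omega]
    simp
  have hT : ∑ i ∈ Finset.range k, griesmerTerm (Fintype.card F) k u₂ u₃ i = (n : ℤ) - 1 := by
    refine mul_left_cancel₀ (sub_ne_zero.2 hq1.ne') ?_
    rw [sub_one_mul_sum_griesmerTerm (by omega) hu₃.le, mul_sub, hG.length_eq hU]
    ring
  rw [Finset.sum_add_distrib, hu, hT] at hsum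
  have hb' : ((∑ i ∈ Finset.range k,
      ⌈((d + 1 : ℕ) : ℚ) / (Fintype.card F : ℚ) ^ i⌉₊ : ℕ) : ℤ) ≤ n := Nat.cast_le.2 hb
  rw [Nat.cast_sum] at hb'
  omega

end Optimality

end SubcodeSupport

/-! ### Assembly of the main theorem. -/

theorem mainTheorem3 {F : Type*} [Field F] [Fintype F] [DecidableEq F] (q : ℕ)
    (hq : Fintype.card F = q) (k u₂ u₃ : ℕ) (hu₂ : 1 < u₂) (hu₂₃ : u₂ < u₃) (hu₃ : u₃ < k)
    (hsum : u₂ + u₃ ≤ k + 1) :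
    (∃ U₂ U₃ : Submodule F (Fin k → F), SubcodeSupport.IsPair u₂ u₃ U₂ U₃) ∧
    ∀ U₂ U₃ : Submodule F (Fin k → F), SubcodeSupport.IsPair u₂ u₃ U₂ U₃ →
      (∃ (n : ℕ) (G : Matrix (Fin k) (Fin n) F),
        SubcodeSupport.IsComplementMatrix U₂ U₃ G) ∧
      ∀ (n : ℕ) (G : Matrix (Fin k) (Fin n) F), SubcodeSupport.IsComplementMatrix U₂ U₃ G →
        ∀ C : Submodule F (Fin n → F), C = SubcodeSupport.rowCode G →
        -- parameters
        ((n : ℚ) = ((q : ℚ) ^ k - 1) / (q - 1) - ((q : ℚ) ^ u₂ - 1) / (q - 1)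
            - ((q : ℚ) ^ u₃ - 1) / (q - 1) + 1 ∧
          Module.finrank F C = k ∧
          (SubcodeSupport.minDist C : ℤ)
            = (q : ℤ) ^ (k - 1) - (q : ℤ) ^ (u₂ - 1) - (q : ℤ) ^ (u₃ - 1)) ∧
        -- weight distribution for `u₂ + u₃ < k + 1`
        (u₂ + u₃ < k + 1 → ∀ d : ℕ, d = SubcodeSupport.minDist C →
          SubcodeSupport.weightCount C 0 = 1 ∧
          (SubcodeSupport.weightCount C d : ℤ)
            = (q : ℤ) ^ (k - 1) - (q : ℤ) ^ (k - u₂) - (q : ℤ) ^ (k - u₃)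
              + (q : ℤ) ^ (k + 1 - u₂ - u₃) ∧
          (SubcodeSupport.weightCount C (d + 1) : ℤ) = (q : ℤ) ^ k - (q : ℤ) ^ (k - 1) ∧
          (SubcodeSupport.weightCount C (d + q ^ (u₂ - 1)) : ℤ)
            = (q : ℤ) ^ (k - u₂) - (q : ℤ) ^ (k + 1 - u₂ - u₃) ∧
          (SubcodeSupport.weightCount C (d + q ^ (u₃ - 1)) : ℤ)
            = (q : ℤ) ^ (k - u₃) - (q : ℤ) ^ (k + 1 - u₂ - u₃) ∧
          (SubcodeSupport.weightCount C (d + q ^ (u₂ - 1) + q ^ (u₃ - 1)) : ℤ)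
            = (q : ℤ) ^ (k + 1 - u₂ - u₃) - 1 ∧
          (∀ j : ℕ, j ∉ ({0, d, d + 1, d + q ^ (u₂ - 1), d + q ^ (u₃ - 1),
              d + q ^ (u₂ - 1) + q ^ (u₃ - 1)} : Set ℕ) →
            SubcodeSupport.weightCount C j = 0) ∧
          SubcodeSupport.IsWeightCode C 5) ∧
        -- weight distribution for `u₂ + u₃ = k + 1`
        (u₂ + u₃ = k + 1 → ∀ d : ℕ, d = SubcodeSupport.minDist C →
          SubcodeSupport.weightCount C 0 = 1 ∧
          (SubcodeSupport.weightCount C d : ℤ)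
            = (q : ℤ) ^ (k - 1) - (q : ℤ) ^ (k - u₂) - (q : ℤ) ^ (k - u₃)
              + (q : ℤ) ^ (k + 1 - u₂ - u₃) ∧
          (SubcodeSupport.weightCount C (d + 1) : ℤ) = (q : ℤ) ^ k - (q : ℤ) ^ (k - 1) ∧
          (SubcodeSupport.weightCount C (d + q ^ (u₂ - 1)) : ℤ)
            = (q : ℤ) ^ (k - u₂) - (q : ℤ) ^ (k + 1 - u₂ - u₃) ∧
          (SubcodeSupport.weightCount C (d + q ^ (u₃ - 1)) : ℤ)
            = (q : ℤ) ^ (k - u₃) - (q : ℤ) ^ (k + 1 - u₂ - u₃) ∧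
          (∀ j : ℕ, j ∉ ({0, d, d + 1, d + q ^ (u₂ - 1), d + q ^ (u₃ - 1)} : Set ℕ) →
            SubcodeSupport.weightCount C j = 0) ∧
          SubcodeSupport.IsWeightCode C 4) ∧
        -- generalized Hamming weights
        (∀ r : ℕ, 1 ≤ r → r < u₂ →
          (SubcodeSupport.ghw C r : ℚ)
            = ((q : ℚ) ^ k - (q : ℚ) ^ (k - r) - ((q : ℚ) ^ u₂ - (q : ℚ) ^ (u₂ - r))
                - ((q : ℚ) ^ u₃ - (q : ℚ) ^ (u₃ - r))) / (q - 1)) ∧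
        (∀ r : ℕ, u₂ ≤ r → r < u₃ →
          (SubcodeSupport.ghw C r : ℚ)
            = ((q : ℚ) ^ k - (q : ℚ) ^ (k - r) - ((q : ℚ) ^ u₂ - 1)
                - ((q : ℚ) ^ u₃ - (q : ℚ) ^ (u₃ - r))) / (q - 1) + 1) ∧
        (∀ r : ℕ, u₃ ≤ r → r ≤ k →
          (SubcodeSupport.ghw C r : ℚ)
            = ((q : ℚ) ^ k - (q : ℚ) ^ (k - r) - ((q : ℚ) ^ u₂ - 1)
                - ((q : ℚ) ^ u₃ - 1)) / (q - 1) + 1) ∧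
        -- subcode support weight distributions; the counts `M` may be taken with respect to any
        -- pair of subspaces with the same dimensions
        (∀ r j : ℕ, 1 ≤ r → r ≤ k → 1 ≤ j → j ≤ n →
          ∀ W₂ W₃ : Submodule F (Fin k → F), SubcodeSupport.IsPair u₂ u₃ W₂ W₃ →
            SubcodeSupport.subcodeCount C r j
              = ∑ v ∈ SubcodeSupport.Z q k u₂ u₃ r j,
                  SubcodeSupport.M W₂ W₃ v.1 v.2.1 v.2.2 (k - r)) ∧
        -- optimality
        SubcodeSupport.IsRGriesmer C u₂ ∧
        SubcodeSupport.IsAlmostGriesmer C ∧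
        SubcodeSupport.IsDistanceOptimal C := by
  subst hq
  refine ⟨SubcodeSupport.exists_isPair hu₂.le (hu₂.trans hu₂₃).le hsum, fun U₂ U₃ hU =>
    ⟨SubcodeSupport.exists_isComplementMatrix U₂ U₃, fun n G hG C hC => ?_⟩⟩
  subst hC
  have hlt := SubcodeSupport.pow_sub_one_add_pow_sub_one_lt
    (Fintype.one_lt_card (α := F)) hu₂.le hu₂₃ hu₃
  obtain ⟨d, hd⟩ : ∃ d : ℕ, (d : ℤ) = (Fintype.card F : ℤ) ^ (k - 1)
      - (Fintype.card F : ℤ) ^ (u₂ - 1) - (Fintype.card F : ℤ) ^ (u₃ - 1) := by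
    refine ⟨Fintype.card F ^ (k - 1) - (Fintype.card F ^ (u₂ - 1) + Fintype.card F ^ (u₃ - 1)), ?_⟩
    push_cast [Nat.cast_sub hlt.le]
    ring
  have hmin := hG.minDist_eq hU hu₂ hu₂₃ hu₃ hsum rfl hd
  have hinj := hG.vecMul_injective hU hu₂ hu₂₃ hu₃
  have hfin := hG.finrank_rowCode hU hu₂ hu₂₃ hu₃
  obtain ⟨w0, w1, w2, w3, w23, wz⟩ := hG.weightCount_eq hU hu₂ hu₂₃ hu₃ hsum rfl hd
  have hw := hG.isWeightCode hU hu₂ hu₂₃ hu₃ hsum rfl hd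
  have hq : (1 : ℚ) < Fintype.card F := by exact_mod_cast Fintype.one_lt_card
  have hq' : (Fintype.card F : ℚ) - 1 ≠ 0 := by linarith
  have hghw : ∀ r, r ≤ k → u₂ ≤ r →
      ((Fintype.card F : ℚ) - 1) * SubcodeSupport.ghw (SubcodeSupport.rowCode G) r
        = (Fintype.card F : ℚ) ^ k - (Fintype.card F : ℚ) ^ u₂ - (Fintype.card F : ℚ) ^ u₃
          + Fintype.card F - (Fintype.card F : ℚ) ^ (k - r)
          + (Fintype.card F : ℚ) ^ (u₃ - r) := fun r hr hur => by
    exact_mod_cast hG.ghw_of_le hU hinj hr hur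
  refine ⟨⟨?_, hfin, by rw [hmin, hd]⟩, ?_, ?_, ?_, ?_, ?_, ?_, ?_, ?_, ?_⟩
  · have hn : ((Fintype.card F : ℚ) - 1) * n = (Fintype.card F : ℚ) ^ k
        - (Fintype.card F : ℚ) ^ u₂ - (Fintype.card F : ℚ) ^ u₃ + Fintype.card F := by
      exact_mod_cast hG.length_eq hU
    field_simp
    linarith
  · rintro h _ rfl
    rw [hmin]
    exact ⟨SubcodeSupport.weightCount_zero _, w0, w1, w2, w3, w23, wz, hw.1 h⟩
  · rintro h _ rfl
    rw [hmin]
    refine ⟨SubcodeSupport.weightCount_zero _, w0, w1, w2, w3, fun j hj => ?_, hw.2 h⟩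
    by_cases hj' : j = d + Fintype.card F ^ (u₂ - 1) + Fintype.card F ^ (u₃ - 1)
    · rw [show k + 1 - u₂ - u₃ = 0 by omega, pow_zero, sub_self] at w23
      rw [hj']
      exact_mod_cast w23
    · refine wz j ?_
      simp only [Set.mem_insert_iff, Set.mem_singleton_iff] at hj ⊢
      tauto
  · intro r _ hr
    have h : ((Fintype.card F : ℚ) - 1) * SubcodeSupport.ghw (SubcodeSupport.rowCode G) r
        = (Fintype.card F : ℚ) ^ k - (Fintype.card F : ℚ) ^ u₂ - (Fintype.card F : ℚ) ^ u₃
          - (Fintype.card F : ℚ) ^ (k - r) + (Fintype.card F : ℚ) ^ (u₂ - r)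
          + (Fintype.card F : ℚ) ^ (u₃ - r) := by
      exact_mod_cast hG.ghw_of_lt hU hinj hu₂₃ hu₃ hr
    rw [eq_div_iff hq', mul_comm, h]
    ring
  · intro r hur hr
    have h := hghw r (by omega) hur
    field_simp
    linarith
  · intro r hur hr
    have h := hghw r hr (by omega)
    rw [Nat.sub_eq_zero_of_le hur, pow_zero] at h
    field_simp
    linarith
  · intro r j _ hr _ _ W₂ W₃ hW
    rw [hG.subcodeCount_eq hU hinj rfl hr j]
    exact Finset.sum_congr rfl fun v _ => (hU.M_eq hW _ _ _ _).symm
  · refine ⟨⟨hu₂.le, by rw [hfin]; omega, hG.griesmerDefect_eq_zero hU hu₂ hu₂₃ hu₃⟩, ?_⟩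
    rintro r ⟨hr, -, h0⟩
    by_contra hru
    rw [hG.griesmerDefect_of_lt hU hu₂ hu₂₃ hu₃ hr (by omega)] at h0
    exact one_ne_zero h0
  · exact hG.griesmerDefect_of_lt hU hu₂ hu₂₃ hu₃ le_rfl hu₂
  · exact hG.isDistanceOptimal hU hu₂ hu₂₃ hu₃ hd hmin
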